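/- **Sommerfeld surface.** Let $P_1,\dots,P_N\in\mathbb{R}^2$ be distinct points, $P_j=(X_1^{(j)},X_2^{(j)})$. Take $M$ copies (sheets) of $\mathbb{R}^2$ and cut all of them along the same finite set of simple, regular $C^1$ arcs, pairwise non-intersecting and avoiding the $P_j$ except at their ends, each connecting some $P_i$ with some $P_j$ or with infinity. For each cut $e$, glue the left side of $e$ on sheet $m$ to the right side of $e$ on sheet $\pi_e(m)$, where $\pi_e$ is an arbitrary permutation of the sheets (and points are glued only to points with the same coordinates). Let $S$ be the resulting surface, $\psi:S\to\mathbb{R}^2$ its natural projection, and $S^\circ=S\setminus\bigcup_jP_j$ the surface without its branch points. **Notation.** Let $$T=\bigcup_{j=1}^N\bigl(L_1^{(j)}\cup L_2^{(j)}\bigr)\subset\mathbb{C}^2,\qquad L_{1}^{(j)}=\{x_1+ i x_2=X_1^{(j)}+ iX_2^{(j)}\},\quad L_{2}^{(j)}=\{x_1- i x_2=X_1^{(j)}- iX_2^{(j)}\}.$$ For $A=(x_1,x_2)\in\mathbb{C}^2$ let $$A_1(A)=(\operatorname{Re}x_1-\operatorname{Im}x_2,\ \operatorname{Im}x_1+\operatorname{Re}x_2),\qquad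 A_2(A)=(\operatorname{Re}x_1+\operatorname{Im}x_2,\ \operatorname{Re}x_2-\operatorname{Im}x_1)$$ be the two real points associated with $A$. A closed smooth contour on $S^\circ$ is a continuous closed curve $\mathbb{R}/\mathbb{Z}\to S^\circ$ whose projection by $\psi$ is $C^\infty$ with nowhere vanishing velocity. **Theorem.** Let $A_0\in S^\circ$, let $B\in\mathbb{C}^2\setminus(T\cup\mathbb{R}^2)$, and let $\sigma:[0,1]\to\mathbb{C}^2$ be a $C^1$ (for instance, smooth) path with $\sigma(0)=\psi(A_0)$, $\sigma(1)=B$ and $\sigma(\tau)\notin T\cup\mathbb{R}^2$ for $0<\tau\le1$. 1. Let $\gamma$ be a closed smooth contour on $S^\circ$ which is the boundary, run through once anticlockwise, of an open neighbourhood $U\subset S^\circ$ of $A_0$ whose closure is compact in $S^\circ$ and is mapped injectively to the plane by $\psi$. Then there is a family $\Gamma(\tau)$, $\tau\in[0,1]$, of closed smooth contours on $S^\circ$, jointly continuous in $\tau$ and in the parameter of the contour, with $\Gamma(0)=\gamma$ and $$A_1(\sigma(\tau))\notin\psi(\Gamma(\tau)),\qquad A_2(\sigma(\tau))\notin\psi(\Gamma(\tau))\qquad\text{for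 all }\tau\in[0,1].$$ 2. Let $k\in\mathbb{C}$ and let $u:S^\circ\to\mathbb{C}$ be $C^2$ with $(\partial_{x_1}^2+\partial_{x_2}^2+k^2)u=0$ in the local coordinates given by $\psi$. Then $u$ has an analytic continuation $u_{\rm c}$ along $\sigma$: for each $\tau\in[0,1]$ there is a germ of a holomorphic function of two variables at $\sigma(\tau)$, solving the complex Helmholtz equation $(\partial_{x_1}^2+\partial_{x_2}^2+k^2)u_{\rm c}=0$, such that these germs continue each other along $\sigma$ and the germ at $\tau=0$ agrees, on real points near $\psi(A_0)$, with $u$ on the sheet through $A_0$. -/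

import Mathlib

open Set Filter Topology
open scoped ContDiff

/-- The data from which an `M`-sheeted Sommerfeld surface with `N` branch points and `K` cuts is
assembled. The real plane is identified with `ℂ` through `(x₁, x₂) ↦ x₁ + i x₂`.

Every sheet is a copy of the plane carrying the same cuts (a cut which is not needed on a sheet is
spurious, i.e. glued to itself). The cut number `e` is parametrised by `0 < t < 1`, starts at a
branch point, and ends at a branch point or at infinity. The left side of the cut `e` on the sheet
`m` is glued, as a whole, to the right side of the cut `e` on the sheet `glue e m`. -/
structure SommerfeldSurface (N M K : ℕ) where
  /-- the affixes of the branch points -/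
  P : Fin N → ℂ
  P_injective : Function.Injective P
  /-- the parametrised cuts -/
  cut : Fin K → ℝ → ℂ
  cut_contDiffOn : ∀ e, ContDiffOn ℝ 1 (cut e) (Ioo 0 1)
  cut_deriv_ne_zero : ∀ e, ∀ t ∈ Ioo (0 : ℝ) 1, deriv (cut e) t ≠ 0
  /-- a cut does not cross itself, and different cuts do not meet -/
  cut_disjoint : ∀ e e', ∀ t ∈ Ioo (0 : ℝ) 1, ∀ t' ∈ Ioo (0 : ℝ) 1,
    cut e t = cut e' t' → e = e' ∧ t = t'
  cut_ne_P : ∀ e, ∀ t ∈ Ioo (0 : ℝ) 1, ∀ j, cut e t ≠ P j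
  cut_start : ∀ e, ∃ j, Tendsto (cut e) (𝓝[>] 0) (𝓝 (P j))
  cut_end : ∀ e, (∃ j, Tendsto (cut e) (𝓝[<] 1) (𝓝 (P j))) ∨
    Tendsto (cut e) (𝓝[<] 1) (cocompact ℂ)
  /-- the gluing scheme -/
  glue : Fin K → Equiv.Perm (Fin M)

namespace SommerfeldSurface

variable {N M K : ℕ}

/-- The points of the Sommerfeld surface `S` other than its branch points, i.e. `S ∖ ⋃ⱼ Pⱼ`.
Over a point of a cut `e` there are `2 M` points on the sides of the cut, glued in pairs; the one
with `sheet = m` is the common point of the left side of `e` on the sheet `m` and the right side of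
`e` on the sheet `glue e m`. -/
@[ext]
structure Pt (S : SommerfeldSurface N M K) where
  /-- the natural projection `ψ` to the real plane -/
  base : ℂ
  base_ne : ∀ j, base ≠ S.P j
  sheet : Fin M

/-- The topology of the glued surface. Away from the cuts, the neighbourhoods of a point are those
of its sheet. At a point `x` of the cut `e`, with parameter `t`, the points near `x` are the points
`cut e t' + s i (cut e)'(t)`, for `(t', s)` close to `(t, 0)`: those on the left of the cut or on
the cut (`s ≥ 0`) carry the label `x.sheet`, those on the right (`s < 0`) lie on the sheet that is
glued there. -/
instance (S : SommerfeldSurface N M K) : TopologicalSpace S.Pt where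
  IsOpen U := ∀ x ∈ U,
    ((∀ e, ∀ t ∈ Ioo (0 : ℝ) 1, S.cut e t ≠ x.base) →
      ∀ᶠ w in 𝓝 x.base, ∀ y : S.Pt, y.base = w → y.sheet = x.sheet → y ∈ U) ∧
    (∀ e, ∀ t ∈ Ioo (0 : ℝ) 1, S.cut e t = x.base →
      ∀ᶠ p : ℝ × ℝ in 𝓝 (t, 0), ∀ y : S.Pt,
        y.base = S.cut e p.1 + p.2 * (Complex.I * deriv (S.cut e) t) →
        y.sheet = (if 0 ≤ p.2 then x.sheet else S.glue e x.sheet) → y ∈ U)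
  isOpen_univ := fun _ _ => ⟨fun _ => by simp, fun _ _ _ _ => by simp⟩
  isOpen_inter := fun U V hU hV x hx => by
    refine ⟨fun h => ?_, fun e t ht h => ?_⟩
    · filter_upwards [(hU x hx.1).1 h, (hV x hx.2).1 h] with w h₁ h₂ y hy hs
      exact ⟨h₁ y hy hs, h₂ y hy hs⟩
    · filter_upwards [(hU x hx.1).2 e t ht h, (hV x hx.2).2 e t ht h] with w h₁ h₂ y hy hs
      exact ⟨h₁ y hy hs, h₂ y hy hs⟩
  isOpen_sUnion := fun C hC x ⟨U, hU, hx⟩ => by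
    refine ⟨fun h => ?_, fun e t ht h => ?_⟩
    · filter_upwards [(hC U hU x hx).1 h] with w h₁ y hy hs
      exact ⟨U, hU, h₁ y hy hs⟩
    · filter_upwards [(hC U hU x hx).2 e t ht h] with w h₁ y hy hs
      exact ⟨U, hU, h₁ y hy hs⟩

/-- The 2-line `L₁⁽ʲ⁾` of `ℂ²`. -/
def L₁ (S : SommerfeldSurface N M K) (j : Fin N) : Set (ℂ × ℂ) :=
  {x | x.1 + Complex.I * x.2 = (S.P j).re + Complex.I * (S.P j).im}

/-- The 2-line `L₂⁽ʲ⁾` of `ℂ²`. -/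
def L₂ (S : SommerfeldSurface N M K) (j : Fin N) : Set (ℂ × ℂ) :=
  {x | x.1 - Complex.I * x.2 = (S.P j).re - Complex.I * (S.P j).im}

/-- The singularity set `T`, the union of all the 2-lines. -/
def T (S : SommerfeldSurface N M K) : Set (ℂ × ℂ) :=
  ⋃ j, S.L₁ j ∪ S.L₂ j

/-- `s` is a local sheet (a continuous section of `ψ`) of `S` over the set `V`. -/
def IsLocalSheet (S : SommerfeldSurface N M K) (V : Set ℂ) (s : ℂ → S.Pt) : Prop :=
  ContinuousOn s V ∧ ∀ z ∈ V, (s z).base = z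

/-- `u` obeys the real Helmholtz equation with wavenumber `k` on `S ∖ ⋃ⱼ Pⱼ`: read on any sample of
an open set of the plane, it is `C²` and `(∂₁² + ∂₂² + k²) u = 0`. -/
def ObeysHelmholtz (S : SommerfeldSurface N M K) (k : ℂ) (u : S.Pt → ℂ) : Prop :=
  ∀ (V : Set ℂ) (s : ℂ → S.Pt), IsOpen V → S.IsLocalSheet V s →
    ContDiffOn ℝ 2 (fun z => u (s z)) V ∧
    ∀ z ∈ V, Laplacian.laplacian (fun w => u (s w)) z + k ^ 2 * u (s z) = 0

/-- A closed smooth oriented contour on `S ∖ ⋃ⱼ Pⱼ`, parametrised with period `1` (and with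
nowhere vanishing velocity). -/
structure IsContour (S : SommerfeldSurface N M K) (γ : ℝ → S.Pt) : Prop where
  continuous : Continuous γ
  periodic : Function.Periodic γ 1
  smooth : ContDiff ℝ ∞ (fun θ => (γ θ).base)
  velocity_ne_zero : ∀ θ, deriv (fun θ => (γ θ).base) θ ≠ 0

/-- `γ` is the boundary, run through once anticlockwise, of a neighbourhood `U ⊆ S ∖ ⋃ⱼ Pⱼ` of `A₀`
which is so small that its closure is compact in `S ∖ ⋃ⱼ Pⱼ` and is mapped injectively to the plane
by `ψ`. -/
structure IsSmallBoundary (S : SommerfeldSurface N M K) (A₀ : S.Pt) (γ : ℝ → S.Pt) : Prop where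
  isContour : S.IsContour γ
  simple : InjOn γ (Ico 0 1)
  boundary : ∃ U : Set S.Pt, IsOpen U ∧ A₀ ∈ U ∧ IsCompact (closure U) ∧
    InjOn Pt.base (closure U) ∧ frontier U = range γ
  anticlockwise : ∫ θ in (0 : ℝ)..1,
    deriv (fun θ => (γ θ).base) θ / ((γ θ).base - A₀.base) = 2 * Real.pi * Complex.I

end SommerfeldSurface

/-- The real plane `ℝ²` inside `ℂ²`. -/
def realPlane : Set (ℂ × ℂ) := {x | x.1.im = 0 ∧ x.2.im = 0}

/-- The point of `ℝ² ⊆ ℂ²` with affix `z = x₁ + i x₂`. -/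
def ofPlane (z : ℂ) : ℂ × ℂ := ((z.re : ℂ), (z.im : ℂ))

/-- The first real point associated with `A ∈ ℂ²`. -/
def realPoint₁ (A : ℂ × ℂ) : ℂ := ⟨A.1.re - A.2.im, A.1.im + A.2.re⟩

/-- The second real point associated with `A ∈ ℂ²`. -/
def realPoint₂ (A : ℂ × ℂ) : ℂ := ⟨A.1.re + A.2.im, A.2.re - A.1.im⟩

namespace SommerfeldSurface

variable {N M K : ℕ}

/-- `Γ τ`, `0 ≤ τ ≤ 1`, is a homotopical deformation of the contour `γ` on `S ∖ ⋃ⱼ Pⱼ` through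
closed smooth contours, such that the projection of `Γ τ` never contains either of the real points
associated with `σ τ`. -/
structure IsContourFamily (S : SommerfeldSurface N M K) (σ : ℝ → ℂ × ℂ) (γ : ℝ → S.Pt)
    (Γ : ℝ → ℝ → S.Pt) : Prop where
  isContour : ∀ τ ∈ Icc (0 : ℝ) 1, S.IsContour (Γ τ)
  continuousOn : ContinuousOn (fun p : ℝ × ℝ => Γ p.1 p.2) (Icc 0 1 ×ˢ univ)
  start : Γ 0 = γ
  avoids₁ : ∀ τ ∈ Icc (0 : ℝ) 1, realPoint₁ (σ τ) ∉ Pt.base '' range (Γ τ)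
  avoids₂ : ∀ τ ∈ Icc (0 : ℝ) 1, realPoint₂ (σ τ) ∉ Pt.base '' range (Γ τ)

/-- `f` is an analytic continuation of `u` along the path `σ : [0, 1] → ℂ²` which starts over
`A₀`: `f τ` represents a germ of a holomorphic function at `σ τ` that solves the complex Helmholtz
equation, these germs continue each other, and the germ at the start agrees on the real plane with
`u`, read on the sheet through `A₀`. -/
structure IsContinuationAlong (S : SommerfeldSurface N M K) (k : ℂ) (u : S.Pt → ℂ) (A₀ : S.Pt)
    (σ : ℝ → ℂ × ℂ) (f : ℝ → ℂ × ℂ → ℂ) : Prop where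
  analytic : ∀ τ ∈ Icc (0 : ℝ) 1, AnalyticAt ℂ (f τ) (σ τ)
  helmholtz : ∀ τ ∈ Icc (0 : ℝ) 1, ∀ᶠ x in 𝓝 (σ τ),
    iteratedFDeriv ℂ 2 (f τ) x ![(1, 0), (1, 0)] + iteratedFDeriv ℂ 2 (f τ) x ![(0, 1), (0, 1)]
      + k ^ 2 * f τ x = 0
  coherent : ∀ τ ∈ Icc (0 : ℝ) 1, ∀ᶠ τ' in 𝓝[Icc 0 1] τ, f τ' =ᶠ[𝓝 (σ τ')] f τ
  start : ∃ (V : Set ℂ) (s : ℂ → S.Pt), IsOpen V ∧ A₀.base ∈ V ∧ S.IsLocalSheet V s ∧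
    s A₀.base = A₀ ∧ ∀ z ∈ V, f 0 (ofPlane z) = u (s z)

end SommerfeldSurface

/-! In the characteristic coordinates `z = x₁ + i x₂`, `w = x₁ - i x₂` a point `A` of `ℂ²` is `(A₁,
conj A₂)`. Hence `A` lies on `T` exactly when one of its real points is a branch point, and on `ℝ²`
exactly when the two real points coincide. Along `σ` the real points therefore start together at
`ψ(A₀)`, never meet a branch point, and separate at once. The two assertions are then proved
independently of each other.

Contours. The projected contour is carried along by diffeomorphisms of the plane. While the real
points are still close to `A₀`, the contour rests. Later they keep a positive distance from each
other and from the branch points, so short displacements of both points, cut off by bump functions,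
extend to injective immersions of the plane which fix the branch points
(`IsLoopAvoiding.pushPoints`). Finitely many pushes cover `[0, 1]`. The resulting planar homotopy
lifts because `ψ` is a covering of the plane without the branch points (`isCoveringMapOn_base`), and
uniqueness of lifts keeps the curves closed.

Continuation. The equation reads `∂_z ∂_w U = c U` with `c = -k² / 4`. Let `R(z, w; ζ, η)` be the
Riemann function, equal to 1 on `ζ = z` and on `η = w`. For a solution `v` on the real plane the
form `ω = R ∂v dζ + v ∂_η R dζ̄` is closed. If `v` had a holomorphic extension `V`, integrating `ω`
from `(w̄, w)` through `(z, w)` to `(z, z̄)` would give `V(z, w) - v(w̄)` on the first leg and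
nothing on the second. This suggests `U(z, w) = ∫^z ω + v(w̄) - ∫^{w̄} ω`, in which only real paths
occur: from `A₀` to `A₁` and from `A₀` to `A₂`, lifted to the surface, with the branches of `u`
along them. The boundary values of `R` make the endpoint contributions complex-linear, so `U` is
complex differentiable, hence analytic by Osgood's lemma; they also give the mixed equation
(`solvesMixedAt_fst`, `solvesMixedAt_snd`). Closedness of `ω` makes the germs coherent
(`pathIntegral_coherent`). At a real point `w = z̄` near the start the integrals cancel and `U = v`.
-/

/-- If `x + ε = i (y + ε')` with errors small against `|x|` and against `y ≥ 0`, then `y = 0`. -/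
theorem Complex.not_pos_of_norm_sub_I_mul_le {x y : ℝ}
    (h : ‖(x : ℂ) - Complex.I * y‖ ≤ (|x| + |y|) / 8) : y = 0 := by
  have h₁ := Complex.abs_re_le_norm ((x : ℂ) - Complex.I * y)
  have h₂ := Complex.abs_im_le_norm ((x : ℂ) - Complex.I * y)
  simp at h₁ h₂
  have := abs_nonneg x
  have := abs_nonneg y
  exact abs_eq_zero.1 (by linarith)

/-! ### The surface without its branch points is a covering of the punctured plane -/

namespace SommerfeldSurface

variable {N M K : ℕ} (S : SommerfeldSurface N M K)

/-- The branch points. -/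
def branch : Set ℂ := range S.P

theorem isClosed_branch : IsClosed S.branch := (finite_range S.P).isClosed

theorem notMem_branch {z : ℂ} : z ∉ S.branch ↔ ∀ j, z ≠ S.P j := by
  simp [branch, eq_comm]

theorem Pt.base_notMem_branch {S : SommerfeldSurface N M K} (x : S.Pt) : x.base ∉ S.branch :=
  S.notMem_branch.2 x.base_ne

theorem contDiffAt_cut (e : Fin K) {t : ℝ} (ht : t ∈ Ioo (0 : ℝ) 1) :
    ContDiffAt ℝ 1 (S.cut e) t :=
  (S.cut_contDiffOn e).contDiffAt (isOpen_Ioo.mem_nhds ht)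

theorem hasStrictDerivAt_cut (e : Fin K) {t : ℝ} (ht : t ∈ Ioo (0 : ℝ) 1) :
    HasStrictDerivAt (S.cut e) (deriv (S.cut e) t) t :=
  (S.contDiffAt_cut e ht).hasStrictDerivAt one_ne_zero

theorem continuousAt_deriv_cut (e : Fin K) {t : ℝ} (ht : t ∈ Ioo (0 : ℝ) 1) :
    ContinuousAt (deriv (S.cut e)) t := by
  have h := (S.cut_contDiffOn e).continuousOn_deriv_of_isOpen isOpen_Ioo le_rfl
  exact h.continuousAt (isOpen_Ioo.mem_nhds ht)

/-- A relatively closed piece of a cut stays away from every point outside it which is not a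
branch point. -/
theorem eventually_notMem_cut_image (e : Fin K) {C : Set ℝ} (hC : IsClosed C) {z : ℂ}
    (hz : z ∉ S.branch) (hzC : ∀ t ∈ Ioo (0 : ℝ) 1 ∩ C, S.cut e t ≠ z) :
    ∀ᶠ w in 𝓝 z, ∀ t ∈ Ioo (0 : ℝ) 1 ∩ C, S.cut e t ≠ w := by
  -- Near its ends the cut approaches a branch point or infinity, hence leaves a neighbourhood of
  -- `z`. Only a compact piece of the parameter interval remains, and its image is closed.
  have key : ∀ l : Filter ℝ, ((∃ j, Tendsto (S.cut e) l (𝓝 (S.P j))) ∨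
      Tendsto (S.cut e) l (cocompact ℂ)) → ∃ W ∈ 𝓝 z, ∀ᶠ t in l, S.cut e t ∉ W := by
    rintro l (⟨j, hj⟩ | h)
    · obtain ⟨u, v, hu, hv, hzu, hPv, huv⟩ := t2_separation (S.notMem_branch.1 hz j)
      refine ⟨u, hu.mem_nhds hzu, (hj.eventually (hv.mem_nhds hPv)).mono fun t ht h => ?_⟩
      exact huv.le_bot ⟨h, ht⟩
    · refine ⟨Metric.closedBall z 1, Metric.closedBall_mem_nhds z one_pos, ?_⟩
      exact h.eventually (isCompact_closedBall z 1).compl_mem_cocompact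
  obtain ⟨W₀, hW₀, h₀⟩ := key _ (Or.inl (S.cut_start e))
  obtain ⟨W₁, hW₁, h₁⟩ := key _ (S.cut_end e)
  obtain ⟨a, ha, h₀⟩ := mem_nhdsGT_iff_exists_Ioo_subset.1 h₀
  obtain ⟨b, hb, h₁⟩ := mem_nhdsLT_iff_exists_Ioo_subset.1 h₁
  rw [mem_Ioi] at ha
  rw [mem_Iio] at hb
  have hsub : Icc a b ∩ C ⊆ Ioo 0 1 := fun t ht => ⟨ha.trans_le ht.1.1, ht.1.2.trans_lt hb⟩
  have hcomp : IsCompact (S.cut e '' (Icc a b ∩ C)) :=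
    (isCompact_Icc.inter_right hC).image_of_continuousOn
      ((S.cut_contDiffOn e).continuousOn.mono hsub)
  have hmem : (S.cut e '' (Icc a b ∩ C))ᶜ ∈ 𝓝 z := by
    refine hcomp.isClosed.isOpen_compl.mem_nhds ?_
    rintro ⟨t, ht, rfl⟩
    exact hzC t ⟨hsub ht, ht.2⟩ rfl
  filter_upwards [hmem, hW₀, hW₁] with w hw hw₀ hw₁ t ht hwt
  subst hwt
  rcases lt_or_ge t a with hta | hta
  · exact h₀ ⟨ht.1.1, hta⟩ hw₀
  rcases lt_or_ge b t with htb | htb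
  · exact h₁ ⟨htb, ht.1.2⟩ hw₁
  exact hw ⟨t, ⟨⟨hta, htb⟩, ht.2⟩, rfl⟩

/-- The coordinates `(t, s) ↦ c(t) + s i d` along a cut `c` with a constant direction `i d`. -/
noncomputable def cutChart (e : Fin K) (d : ℂ) (p : ℝ × ℝ) : ℂ :=
  S.cut e p.1 + p.2 * (Complex.I * d)

theorem continuousAt_cutChart (e : Fin K) {t : ℝ} (ht : t ∈ Ioo (0 : ℝ) 1) (s : ℝ) (d : ℂ) :
    ContinuousAt (S.cutChart e d) (t, s) := by
  have : ContinuousAt (S.cut e) t := (S.contDiffAt_cut e ht).continuousAt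
  exact (this.comp (f := Prod.fst) (x := (t, s)) continuousAt_fst).add (by fun_prop)

/-- The partial derivatives at `(t, s)` are `c'(t)` and `i d`, which are independent over `ℝ` as
soon as `c'(t) / d` has nonzero real part. The strict derivative is then onto, so the chart is open.
The direction `d` is left free because the topology uses the normal at each point's own parameter,
while a labelling needs one direction for a whole arc. -/
theorem map_cutChart_nhds (e : Fin K) {t : ℝ} (ht : t ∈ Ioo (0 : ℝ) 1) (s : ℝ) {d : ℂ}
    (hd : 0 < (deriv (S.cut e) t / d).re) :
    map (S.cutChart e d) (𝓝 (t, s)) = 𝓝 (S.cutChart e d (t, s)) := by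
  have hd0 : d ≠ 0 := by rintro rfl; simp at hd
  have h₁ : HasStrictFDerivAt (fun p : ℝ × ℝ => S.cut e p.1)
      ((ContinuousLinearMap.toSpanSingleton ℝ (deriv (S.cut e) t)).comp
        (ContinuousLinearMap.fst ℝ ℝ ℝ)) (t, s) :=
    HasStrictFDerivAt.comp (t, s) (f := Prod.fst) (S.hasStrictDerivAt_cut e ht).hasStrictFDerivAt
      hasStrictFDerivAt_fst
  have h₂ : HasStrictFDerivAt (fun p : ℝ × ℝ => (p.2 : ℂ) * (Complex.I * d))
      ((ContinuousLinearMap.toSpanSingleton ℝ (Complex.I * d)).comp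
        (ContinuousLinearMap.snd ℝ ℝ ℝ)) (t, s) := by
    have := ((ContinuousLinearMap.toSpanSingleton ℝ (Complex.I * d)).comp
        (ContinuousLinearMap.snd ℝ ℝ ℝ)).hasStrictFDerivAt (x := (t, s))
    refine this.congr_of_eventuallyEq (Eventually.of_forall fun p => ?_)
    simp
  refine (h₁.add h₂).map_nhds_eq_of_surj ?_
  rw [LinearMap.range_eq_top]
  intro w
  set q := deriv (S.cut e) t / d with hq
  refine ⟨((w / d).re / q.re, (w / d).im - (w / d).re / q.re * q.im), ?_⟩
  have : deriv (S.cut e) t = q * d := by rw [hq]; field_simp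
  simp [this]
  have h3 : w = (w / d) * d := by field_simp
  conv_rhs => rw [h3]
  rw [← mul_assoc, ← mul_assoc, ← add_mul]
  congr 1
  have : q.re ≠ 0 := hd.ne'
  apply Complex.ext <;> simp
  field_simp

/-- The sides of a cut do not depend on the coordinates used to describe them. -/
theorem cut_sides_disjoint (e : Fin K) {U : Set ℝ} (hU : Convex ℝ U) (hUsub : U ⊆ Ioo 0 1)
    {c : ℂ} (hc : c ≠ 0) (hdc : ∀ t ∈ U, ‖deriv (S.cut e) t - c‖ ≤ ‖c‖ / 8) {t t' s s' : ℝ}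
    (ht : t ∈ U) (ht' : t' ∈ U) {d d' : ℂ} (hd : ‖d - c‖ ≤ ‖c‖ / 8) (hd' : ‖d' - c‖ ≤ ‖c‖ / 8)
    (hs : s < 0) (hs' : 0 ≤ s') (h : S.cutChart e d (t, s) = S.cutChart e d' (t', s')) : False := by
  have hmv : ‖(S.cut e t - t * c) - (S.cut e t' - t' * c)‖ ≤ ‖c‖ / 8 * ‖t - t'‖ := by
    refine hU.norm_image_sub_le_of_norm_hasDerivWithin_le (f := fun t : ℝ => S.cut e t - t * c)
      (f' := fun t => deriv (S.cut e) t - c) (fun x hx => ?_) hdc ht' ht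
    have h₁ := (S.hasStrictDerivAt_cut e (hUsub hx)).hasDerivAt
    have h₂ : HasDerivAt (fun t : ℝ => (t : ℂ) * c) c x := by
      simpa using ((hasDerivAt_id x).ofReal_comp.mul_const c)
    exact (h₁.sub h₂).hasDerivWithinAt
  have hn : 0 < ‖c‖ := norm_pos_iff.2 hc
  have hcut : S.cut e t - S.cut e t' = s' * (Complex.I * d') - s * (Complex.I * d) := by
    simp only [cutChart] at h
    linear_combination h
  -- Both charts differ from `(t, s) ↦ (t + i s) c` by relative errors of at most 1/8, so equality
  -- of the two points puts `t - t'` near `i (s' - s)`. As `s` and `s'` have opposite signs, `|s| +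
  -- |s'|` is `|s' - s|`. The value 1/8 leaves slack: any constant below 1/2 would exclude this.
  have key : ‖((t - t' : ℝ) : ℂ) - Complex.I * ((s' - s : ℝ) : ℂ)‖ ≤ (|t - t'| + |s' - s|) / 8 := by
    have e₁ : (((t - t' : ℝ) : ℂ) - Complex.I * ((s' - s : ℝ) : ℂ)) * c =
        -((S.cut e t - t * c) - (S.cut e t' - t' * c)) +
          (s' * (Complex.I * (d' - c)) - s * (Complex.I * (d - c))) := by
      push_cast
      linear_combination hcut
    have e₂ : ‖((t - t' : ℝ) : ℂ) - Complex.I * ((s' - s : ℝ) : ℂ)‖ * ‖c‖ ≤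
        (|t - t'| + |s' - s|) / 8 * ‖c‖ := by
      rw [← norm_mul, e₁]
      refine (norm_add_le _ _).trans ?_
      rw [norm_neg]
      have h₃ : ‖(s' : ℂ) * (Complex.I * (d' - c)) - s * (Complex.I * (d - c))‖ ≤
          |s'| * (‖c‖ / 8) + |s| * (‖c‖ / 8) := by
        refine (norm_sub_le _ _).trans ?_
        simp only [norm_mul, Complex.norm_I, one_mul, Complex.norm_real, Real.norm_eq_abs]
        gcongr
      have h₄ : |s' - s| = |s'| + |s| := by
        rw [abs_of_nonneg hs', abs_of_neg hs, abs_of_pos (by linarith)]; ring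
      rw [h₄]
      rw [Real.norm_eq_abs] at hmv
      linarith
    exact le_of_mul_le_mul_right e₂ hn
  have := Complex.not_pos_of_norm_sub_I_mul_le key
  linarith

/-- `g` labels the sheets over `V` consistently with the gluing: the `m`-th sheet of the sample
over `V` is the sheet `g z m` at `z`. -/
structure IsLabelling (V : Set ℂ) (g : ℂ → Equiv.Perm (Fin M)) : Prop where
  off_cut : ∀ z ∈ V, (∀ e, ∀ t ∈ Ioo (0 : ℝ) 1, S.cut e t ≠ z) → ∀ᶠ w in 𝓝 z, g w = g z
  on_cut : ∀ z ∈ V, ∀ e, ∀ t ∈ Ioo (0 : ℝ) 1, S.cut e t = z → ∀ᶠ p : ℝ × ℝ in 𝓝 (t, 0),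
    g (S.cutChart e (deriv (S.cut e) t) p) = (if 0 ≤ p.2 then 1 else S.glue e) * g z

/-- Away from the cuts the constant label works. On a cut, a small disc meets only a short arc of
that one cut; the label is 1 on its left, cut included, and the gluing permutation on its right.
"Left" is defined by the fixed normal `i c` at the centre, and `cut_sides_disjoint` reconciles it
with the varying normals of the topology. -/
theorem exists_isLabelling {z : ℂ} (hz : z ∉ S.branch) :
    ∃ V, IsOpen V ∧ z ∈ V ∧ ∃ g, S.IsLabelling V g := by
  by_cases hcut : ∃ e, ∃ t ∈ Ioo (0 : ℝ) 1, S.cut e t = z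
  swap
  · push Not at hcut
    have h : ∀ᶠ w in 𝓝 z, ∀ e, ∀ t ∈ Ioo (0 : ℝ) 1, S.cut e t ≠ w := by
      rw [eventually_all]
      intro e
      simpa using S.eventually_notMem_cut_image e isClosed_univ hz (by simpa using hcut e)
    obtain ⟨V, hV, hVo, hzV⟩ := eventually_nhds_iff.1 h
    exact ⟨V, hVo, hzV, fun _ => 1, fun _ _ _ => by simp,
      fun w hw e t ht htw => (hV w hw e t ht htw).elim⟩
  obtain ⟨e, t₀, ht₀, hz₀⟩ := hcut
  set c := deriv (S.cut e) t₀ with hc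
  have hc0 : c ≠ 0 := S.cut_deriv_ne_zero e t₀ ht₀
  have hcpos : 0 < ‖c‖ := norm_pos_iff.2 hc0
  obtain ⟨η, hη, hU⟩ : ∃ η > 0, ∀ t ∈ Metric.ball t₀ η,
      t ∈ Ioo (0 : ℝ) 1 ∧ ‖deriv (S.cut e) t - c‖ ≤ ‖c‖ / 8 := by
    have hIoo : ∀ᶠ t in 𝓝 t₀, t ∈ Ioo (0 : ℝ) 1 := isOpen_Ioo.mem_nhds ht₀
    refine Metric.eventually_nhds_iff_ball.1 (hIoo.and ?_)
    have := (S.continuousAt_deriv_cut e ht₀).eventually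
      (Metric.closedBall_mem_nhds c (by positivity : 0 < ‖c‖ / 8))
    simpa [Metric.closedBall, dist_eq_norm] using this
  have hUsub : Metric.ball t₀ η ⊆ Ioo 0 1 := fun t ht => (hU t ht).1
  have hUd : ∀ t ∈ Metric.ball t₀ η, ‖deriv (S.cut e) t - c‖ ≤ ‖c‖ / 8 := fun t ht => (hU t ht).2
  have hre : ∀ t ∈ Metric.ball t₀ η, 0 < (deriv (S.cut e) t / c).re := by
    intro t ht
    have h₁ : ‖deriv (S.cut e) t / c - 1‖ ≤ 1 / 8 := by
      rw [div_sub_one hc0, norm_div, div_le_iff₀ hcpos]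
      linarith [hUd t ht]
    have h₂ := (Complex.abs_re_le_norm _).trans h₁
    simp only [Complex.sub_re, Complex.one_re] at h₂
    linarith [(abs_le.1 h₂).1]
  have hcc : ‖c - c‖ ≤ ‖c‖ / 8 := by rw [sub_self, norm_zero]; positivity
  have sides : ∀ t ∈ Metric.ball t₀ η, ∀ t' ∈ Metric.ball t₀ η, ∀ s s' : ℝ, ∀ d d' : ℂ,
      ‖d - c‖ ≤ ‖c‖ / 8 → ‖d' - c‖ ≤ ‖c‖ / 8 → s < 0 → 0 ≤ s' →
      S.cutChart e d (t, s) ≠ S.cutChart e d' (t', s') := fun t ht t' ht' s s' d d' hd hd' hs hs' h =>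
    S.cut_sides_disjoint e (convex_ball t₀ η) hUsub hc0 hUd ht ht' hd hd' hs hs' h
  have hother : ∀ᶠ w in 𝓝 z, ∀ e', ∀ t ∈ Ioo (0 : ℝ) 1, S.cut e' t = w →
      e' = e ∧ t ∈ Metric.ball t₀ η := by
    rw [eventually_all]
    intro e'
    by_cases he : e' = e
    · subst he
      have := S.eventually_notMem_cut_image e' (Metric.isOpen_ball (x := t₀) (ε := η)).isClosed_compl
        hz (fun t ht h => ht.2 (by
          rw [(S.cut_disjoint e' e' t ht.1 t₀ ht₀ (h.trans hz₀.symm)).2]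
          exact Metric.mem_ball_self hη))
      filter_upwards [this] with w hw t ht htw
      exact ⟨rfl, by_contra fun h => hw t ⟨ht, h⟩ htw⟩
    · have := S.eventually_notMem_cut_image e' isClosed_univ hz (fun t ht h =>
        he (S.cut_disjoint e' e t ht.1 t₀ ht₀ (h.trans hz₀.symm)).1)
      filter_upwards [this] with w hw t ht htw
      exact (hw t ⟨ht, trivial⟩ htw).elim
  have hchart : ∀ᶠ w in 𝓝 z, ∃ t ∈ Metric.ball t₀ η, ∃ s : ℝ, S.cutChart e c (t, s) = w := by
    have h₁ := S.map_cutChart_nhds e ht₀ 0 (hre t₀ (Metric.mem_ball_self hη))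
    have h₂ : S.cutChart e c (t₀, 0) = z := by simp [cutChart, hz₀]
    rw [h₂] at h₁
    rw [← h₁, eventually_map]
    have h₃ : ∀ᶠ p : ℝ × ℝ in 𝓝 (t₀, 0), p.1 ∈ Metric.ball t₀ η :=
      continuousAt_fst.eventually (Metric.ball_mem_nhds t₀ hη)
    filter_upwards [h₃] with p hp
    exact ⟨p.1, hp, p.2, rfl⟩
  obtain ⟨V, hV, hVo, hzV⟩ := eventually_nhds_iff.1 (hother.and hchart)
  classical
  set left : Set ℂ := {w | ∃ t ∈ Metric.ball t₀ η, ∃ s : ℝ, 0 ≤ s ∧ S.cutChart e c (t, s) = w}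
  have hball : ∀ t ∈ Metric.ball t₀ η, ∀ s : ℝ, ∀ᶠ p : ℝ × ℝ in 𝓝 (t, s),
      p.1 ∈ Metric.ball t₀ η := fun t ht s =>
    continuousAt_fst.eventually (Metric.isOpen_ball.mem_nhds ht)
  refine ⟨V, hVo, hzV, fun w => if w ∈ left then 1 else S.glue e, ?_, ?_⟩
  · intro w hw hoff
    obtain ⟨t, ht, s, rfl⟩ := (hV w hw).2
    have hs : s ≠ 0 := by
      rintro rfl
      exact hoff e t (hUsub ht) (by simp [cutChart])
    rw [← S.map_cutChart_nhds e (hUsub ht) s (hre t ht), eventually_map]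
    rcases lt_or_gt_of_ne hs with hs | hs
    · have hneg : ∀ t' ∈ Metric.ball t₀ η, ∀ s' < 0, S.cutChart e c (t', s') ∉ left := by
        rintro t' ht' s' hs' ⟨t₁, ht₁, s₁, hs₁, h⟩
        exact sides t' ht' t₁ ht₁ s' s₁ c c hcc hcc hs' hs₁ h.symm
      filter_upwards [hball t ht s, continuousAt_snd.eventually (gt_mem_nhds hs)] with p hp hp'
      rw [if_neg (hneg p.1 hp p.2 hp'), if_neg (hneg t ht s hs)]
    · filter_upwards [hball t ht s, continuousAt_snd.eventually (lt_mem_nhds hs)] with p hp hp'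
      rw [if_pos ⟨p.1, hp, p.2, le_of_lt hp', rfl⟩, if_pos ⟨t, ht, s, hs.le, rfl⟩]
  · intro w hw e' t ht htw
    obtain ⟨rfl, htb⟩ := (hV w hw).1 e' t ht htw
    have hwl : w ∈ left := ⟨t, htb, 0, le_rfl, by simp [cutChart, htw]⟩
    have hd := hUd t htb
    have hcont : ContinuousAt (S.cutChart e' (deriv (S.cut e') t)) (t, 0) :=
      S.continuousAt_cutChart e' ht 0 _
    have hw' : S.cutChart e' (deriv (S.cut e') t) (t, 0) = S.cutChart e' c (t, 0) := by
      simp [cutChart]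
    have hev := hcont.tendsto
    -- Near `(t, 0)` every point of the chart with the normal at `t` is also a point of the chart
    -- with the fixed normal, so the signs of the two transverse coordinates can be compared.
    rw [hw', ← S.map_cutChart_nhds e' ht 0 (hre t htb)] at hev
    have hmap : ∀ᶠ w in map (S.cutChart e' c) (𝓝 (t, 0)), ∃ p : ℝ × ℝ,
        p.1 ∈ Metric.ball t₀ η ∧ S.cutChart e' c p = w :=
      eventually_map.2 ((hball t htb 0).mono fun p hp => ⟨p, hp, rfl⟩)
    have hev' := hev.eventually hmap
    filter_upwards [hball t htb 0, hev'] with p hp hp'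
    obtain ⟨q, hq, hqp⟩ := hp'
    simp only [if_pos hwl, mul_one]
    by_cases hp2 : 0 ≤ p.2
    · rw [if_pos hp2, if_pos]
      refine ⟨q.1, hq, q.2, ?_, hqp⟩
      by_contra hq2
      exact sides q.1 hq p.1 hp q.2 p.2 c _ hcc hd (not_le.1 hq2) hp2 hqp
    · rw [if_neg hp2, if_neg]
      rintro ⟨t₁, ht₁, s₁, hs₁, h⟩
      exact sides p.1 hp t₁ ht₁ p.2 s₁ _ c hd hcc (not_le.1 hp2) hs₁ h.symm

variable {S}

theorem IsLabelling.isOpen_sheet {V : Set ℂ} {g : ℂ → Equiv.Perm (Fin M)} (hg : S.IsLabelling V g)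
    {W : Set ℂ} (hW : IsOpen W) (hWV : W ⊆ V) (m : Fin M) :
    IsOpen {y : S.Pt | y.base ∈ W ∧ y.sheet = g y.base m} := by
  intro x hx
  refine ⟨fun hoff => ?_, fun e t ht htx => ?_⟩
  · filter_upwards [hW.mem_nhds hx.1, hg.off_cut _ (hWV hx.1) hoff] with w hw hgw y hy hs
    subst hy
    exact ⟨hw, by rw [hs, hx.2, hgw]⟩
  · have hcont : ContinuousAt (S.cutChart e (deriv (S.cut e) t)) (t, 0) :=
      S.continuousAt_cutChart e ht 0 _
    have hmem : W ∈ 𝓝 (S.cutChart e (deriv (S.cut e) t) (t, 0)) := by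
      refine hW.mem_nhds ?_
      simpa [cutChart, htx] using hx.1
    filter_upwards [hcont.eventually hmem, hg.on_cut _ (hWV hx.1) e t ht htx] with p hp hgp y hy hs
    change y.base = S.cutChart e (deriv (S.cut e) t) p at hy
    refine ⟨by rw [hy]; exact hp, ?_⟩
    rw [hs, hx.2, hy, hgp]
    split_ifs <;> simp

/-- A neighbourhood in the surface contains, by definition of its topology, points over a full
planar neighbourhood; at a cut this uses that the chart is open. With `IsLabelling.isOpen_sheet` it
follows that `ψ` restricts to a homeomorphism on each labelled sheet. -/
theorem isOpen_of_isOpen_sheet {g : ℂ → Equiv.Perm (Fin M)} {W : Set ℂ} (hW : Disjoint W S.branch) (m : Fin M)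
    (h : IsOpen {y : S.Pt | y.base ∈ W ∧ y.sheet = g y.base m}) : IsOpen W := by
  rw [isOpen_iff_mem_nhds]
  intro z hz
  have hzb : z ∉ S.branch := fun hb => hW.le_bot ⟨hz, hb⟩
  have hnb : ∀ᶠ w in 𝓝 z, w ∉ S.branch := S.isClosed_branch.isOpen_compl.mem_nhds hzb
  obtain ⟨h₁, h₂⟩ := h ⟨z, S.notMem_branch.1 hzb, g z m⟩ ⟨hz, rfl⟩
  by_cases hoff : ∀ e, ∀ t ∈ Ioo (0 : ℝ) 1, S.cut e t ≠ z
  · filter_upwards [h₁ hoff, hnb] with w hw hwb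
    exact (hw ⟨w, S.notMem_branch.1 hwb, g z m⟩ rfl rfl).1
  · push Not at hoff
    obtain ⟨e, t, ht, rfl⟩ := hoff
    have hd : 0 < (deriv (S.cut e) t / deriv (S.cut e) t).re := by
      rw [div_self (S.cut_deriv_ne_zero e t ht)]; simp
    have hmap := S.map_cutChart_nhds e ht 0 hd
    have h0 : S.cutChart e (deriv (S.cut e) t) (t, 0) = S.cut e t := by simp [cutChart]
    rw [h0] at hmap
    rw [← hmap] at hnb ⊢
    rw [eventually_map] at hnb
    rw [mem_map]
    filter_upwards [h₂ e t ht rfl, hnb] with p hp hpb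
    exact (hp ⟨S.cutChart e (deriv (S.cut e) t) p, S.notMem_branch.1 hpb, _⟩ rfl rfl).1

variable (S)

/-- A labelling splits the preimage of a small disc into `M` open sheets, indexed by `m`. They are
disjoint and exhaust the preimage because each `g z` is a permutation. -/
theorem isCoveringMapOn_base [Nonempty (Fin M)] :
    IsCoveringMapOn (Pt.base : S.Pt → ℂ) S.branchᶜ := by
  intro z hz
  obtain ⟨V₀, hV₀, hzV₀, g, hg⟩ := S.exists_isLabelling hz
  set V := V₀ ∩ S.branchᶜ
  have hV : IsOpen V := hV₀.inter S.isClosed_branch.isOpen_compl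
  have hVV : V ⊆ V₀ := inter_subset_left
  have hVb : Disjoint V S.branch := disjoint_left.2 fun w hw => hw.2
  have hzV : z ∈ V := ⟨hzV₀, hz⟩
  have : Nonempty (ℂ → S.Pt) := ⟨fun _ => ⟨z, S.notMem_branch.1 hz, Classical.arbitrary _⟩⟩
  set U : Fin M → Set S.Pt := fun m => {y | y.base ∈ V ∧ y.sheet = g y.base m}
  have hUW : ∀ m, ∀ W ⊆ V, (Pt.base ⁻¹' W ∩ U m) =
      {y : S.Pt | y.base ∈ W ∧ y.sheet = g y.base m} := by
    intro m W hWV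
    ext y
    simp only [U, mem_inter_iff, mem_preimage, mem_ofPred_eq]
    exact ⟨fun h => ⟨h.1, h.2.2⟩, fun h => ⟨h.1, hWV h.1, h.2⟩⟩
  refine (IsEvenlyCovered.of_trivialization (t := hV.trivializationDiscrete U V
    (fun m W hWV => ?_) (fun m x hx y hy hxy => ?_) (fun m w hw => ?_) (fun m m' hmm => ?_)
    (fun y hy => ?_)) hzV).to_isEvenlyCovered_preimage
  · rw [hUW m W hWV]
    exact ⟨fun h => hg.isOpen_sheet h (hWV.trans hVV) m,
      fun h => isOpen_of_isOpen_sheet (hVb.mono_left hWV) m h⟩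
  · exact Pt.ext hxy (by rw [hx.2, hy.2, hxy])
  · exact ⟨⟨w, S.notMem_branch.1 hw.2, g w m⟩, ⟨hw, rfl⟩, rfl⟩
  · refine disjoint_left.2 fun y hy hy' => hmm ((g y.base).injective ?_)
    rw [← hy.2, ← hy'.2]
  · exact mem_iUnion.2 ⟨(g y.base).symm y.sheet, hy, by simp⟩

theorem continuous_base [Nonempty (Fin M)] : Continuous (Pt.base : S.Pt → ℂ) :=
  continuous_iff_continuousAt.2 fun x => S.isCoveringMapOn_base.continuousAt x.base_notMem_branch

theorem isLocalHomeomorph_base [Nonempty (Fin M)] : IsLocalHomeomorph (Pt.base : S.Pt → ℂ) := by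
  have h := S.isCoveringMapOn_base.isLocalHomeomorphOn
  intro x
  exact h x x.base_notMem_branch

end SommerfeldSurface

/-! ### Deforming a plane loop away from two moving points -/

/-- A smooth regular closed curve of period `1` in the plane which avoids the set `P` and the
points `a` and `b`. -/
structure IsLoopAvoiding (P : Set ℂ) (a b : ℂ) (c : ℝ → ℂ) : Prop where
  smooth : ContDiff ℝ ∞ c
  periodic : Function.Periodic c 1
  velocity_ne_zero : ∀ θ, deriv c θ ≠ 0
  notMem : ∀ θ, c θ ∉ P
  ne_left : ∀ θ, c θ ≠ a
  ne_right : ∀ θ, c θ ≠ b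

/-- The displacement of the plane which moves `a` to `a'` and `b` to `b'` and is cut off by `χ`. -/
noncomputable def pushPoints (χ : ℂ → ℝ) (a b a' b' z : ℂ) : ℂ :=
  z + (χ (z - a) • (a' - a) + χ (z - b) • (b' - b))

theorem pushPoints_self (χ : ℂ → ℝ) (a b z : ℂ) : pushPoints χ a b a b z = z := by
  simp [pushPoints]

theorem pushPoints_lipschitz {χ : ℂ → ℝ} {C : NNReal} (hχ : LipschitzWith C χ) {a b a' b' : ℂ}
    (ha : C * ‖a' - a‖ ≤ 1 / 4) (hb : C * ‖b' - b‖ ≤ 1 / 4) :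
    LipschitzWith (1 / 2) fun z => χ (z - a) • (a' - a) + χ (z - b) • (b' - b) := by
  refine LipschitzWith.of_dist_le_mul fun z w => ?_
  have h : ∀ p : ℂ, |χ (z - p) - χ (w - p)| ≤ C * ‖z - w‖ := fun p => by
    have := hχ.dist_le_mul (z - p) (w - p)
    simpa [dist_eq_norm] using this
  have e : χ (z - a) • (a' - a) + χ (z - b) • (b' - b) -
      (χ (w - a) • (a' - a) + χ (w - b) • (b' - b)) =
      (χ (z - a) - χ (w - a)) • (a' - a) + (χ (z - b) - χ (w - b)) • (b' - b) := by
    simp only [sub_smul]; abel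
  rw [dist_eq_norm, e, dist_eq_norm]
  refine (norm_add_le _ _).trans ?_
  rw [norm_smul, norm_smul, Real.norm_eq_abs, Real.norm_eq_abs]
  have h₁ := mul_le_mul_of_nonneg_right (h a) (norm_nonneg (a' - a))
  have h₂ := mul_le_mul_of_nonneg_right (h b) (norm_nonneg (b' - b))
  have h₃ := mul_le_mul_of_nonneg_right ha (norm_nonneg (z - w))
  have h₄ := mul_le_mul_of_nonneg_right hb (norm_nonneg (z - w))
  push_cast
  linarith

/-- The push is the identity plus a map with Lipschitz constant 1/2, hence injective with invertible
derivative, so regularity survives. The bumps around `a` and `b` have radius `d`, which keeps each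
from acting on the other point and on `P`. Thus `a ↦ a'`, `b ↦ b'`, `P` is fixed pointwise, and by
injectivity a loop missing the old points is sent to one missing the new points. -/
theorem IsLoopAvoiding.pushPoints {P : Set ℂ} {a b a' b' : ℂ} {c : ℝ → ℂ}
    (hc : IsLoopAvoiding P a b c) {χ : ℂ → ℝ} {C : NNReal} {d : ℝ} (hχ : LipschitzWith C χ)
    (hχs : ContDiff ℝ ∞ χ) (hχ0 : χ 0 = 1) (hχd : ∀ z, d ≤ ‖z‖ → χ z = 0)
    (ha : C * ‖a' - a‖ ≤ 1 / 4) (hb : C * ‖b' - b‖ ≤ 1 / 4) (hab : d ≤ ‖a - b‖)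
    (haP : ∀ p ∈ P, d ≤ ‖a - p‖) (hbP : ∀ p ∈ P, d ≤ ‖b - p‖) :
    IsLoopAvoiding P a' b' fun θ => pushPoints χ a b a' b' (c θ) := by
  set g : ℂ → ℂ := fun z => χ (z - a) • (a' - a) + χ (z - b) • (b' - b) with hg
  have hgl : LipschitzWith (1 / 2) g := pushPoints_lipschitz hχ ha hb
  have hgs : ContDiff ℝ ∞ g := by
    have : ∀ p q : ℂ, ContDiff ℝ ∞ fun z => χ (z - p) • q := fun p q =>
      (hχs.comp (contDiff_id.sub contDiff_const)).smul contDiff_const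
    exact (this _ _).add (this _ _)
  have hinj : ∀ z w, _root_.pushPoints χ a b a' b' z = _root_.pushPoints χ a b a' b' w → z = w := by
    intro z w h
    have h₁ := hgl.dist_le_mul z w
    have h₂ : z - w = g w - g z := by
      simp only [_root_.pushPoints] at h
      simp only [hg]
      linear_combination h
    rw [dist_eq_norm, dist_eq_norm, norm_sub_rev, ← h₂] at h₁
    push_cast at h₁
    have : ‖z - w‖ = 0 := le_antisymm (by linarith) (norm_nonneg _)
    exact sub_eq_zero.1 (norm_eq_zero.1 this)
  have hfix : ∀ p, d ≤ ‖a - p‖ → d ≤ ‖b - p‖ → _root_.pushPoints χ a b a' b' p = p := by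
    intro p h₁ h₂
    simp [_root_.pushPoints, hχd (p - a) (by rwa [norm_sub_rev]),
      hχd (p - b) (by rwa [norm_sub_rev])]
  have hleft : _root_.pushPoints χ a b a' b' a = a' := by
    simp [_root_.pushPoints, hχ0, hχd (a - b) hab]
  have hright : _root_.pushPoints χ a b a' b' b = b' := by
    simp [_root_.pushPoints, hχ0, hχd (b - a) (by rwa [norm_sub_rev])]
  refine ⟨hc.smooth.add (hgs.comp hc.smooth), fun θ => ?_, fun θ h => ?_, fun θ h => ?_,
    fun θ h => ?_, fun θ h => ?_⟩
  · simp only [hc.periodic θ]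
  · have h₁ : HasDerivAt c (deriv c θ) θ :=
      (hc.smooth.differentiable (by simp)).differentiableAt.hasDerivAt
    have h₂ := (hgs.differentiable (by simp)).differentiableAt (x := c θ) |>.hasFDerivAt
    have h₃ : deriv (fun θ => _root_.pushPoints χ a b a' b' (c θ)) θ =
        deriv c θ + fderiv ℝ g (c θ) (deriv c θ) := (h₁.add (h₂.comp_hasDerivAt θ h₁)).deriv
    rw [h₃] at h
    have h₄ : ‖fderiv ℝ g (c θ)‖ ≤ 1 / 2 := by
      simpa using norm_fderiv_le_of_lipschitz ℝ hgl (x₀ := c θ)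
    have h₅ := (fderiv ℝ g (c θ)).le_of_opNorm_le h₄ (deriv c θ)
    rw [← neg_eq_of_add_eq_zero_right h, norm_neg] at h₅
    have : ‖deriv c θ‖ = 0 := le_antisymm (by linarith) (norm_nonneg _)
    exact hc.velocity_ne_zero θ (norm_eq_zero.1 this)
  · have h₁ := hfix _ (haP _ h) (hbP _ h)
    exact hc.notMem θ (by rw [← hinj _ _ h₁]; exact h)
  · exact hc.ne_left θ (hinj _ _ (h.trans hleft.symm))
  · exact hc.ne_right θ (hinj _ _ (h.trans hright.symm))

/-- A continuous family of loops with parameter in `[0, T]`. -/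
structure IsLoopFamily (P : Set ℂ) (a b : ℝ → ℂ) (c : ℝ → ℂ) (T : ℝ) (C : ℝ → ℝ → ℂ) : Prop where
  continuousOn : ContinuousOn (fun p : ℝ × ℝ => C p.1 p.2) (Icc 0 T ×ˢ univ)
  start : C 0 = c
  avoiding : ∀ τ ∈ Icc 0 T, IsLoopAvoiding P (a τ) (b τ) (C τ)

/-- The loop at time `T` is pushed onwards. Truncating by `min τ T` and `max τ T` gives one formula
for both ranges: before `T` the displacement is zero, after `T` the loop is frozen. Continuity at
`T` therefore needs no gluing. -/
theorem IsLoopFamily.extend {P : Set ℂ} {a b c : ℝ → ℂ} {T T' : ℝ} {C : ℝ → ℝ → ℂ}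
    (hC : IsLoopFamily P a b c T C) (ha : Continuous a) (hb : Continuous b) (hT : 0 ≤ T)
    {χ : ℂ → ℝ} {L : NNReal} {d : ℝ} (hχ : LipschitzWith L χ)
    (hχs : ContDiff ℝ ∞ χ) (hχ0 : χ 0 = 1) (hχd : ∀ z, d ≤ ‖z‖ → χ z = 0)
    (haT : ∀ τ ∈ Icc T T', L * ‖a τ - a T‖ ≤ 1 / 4) (hbT : ∀ τ ∈ Icc T T', L * ‖b τ - b T‖ ≤ 1 / 4)
    (hab : d ≤ ‖a T - b T‖) (haP : ∀ p ∈ P, d ≤ ‖a T - p‖) (hbP : ∀ p ∈ P, d ≤ ‖b T - p‖) :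
    ∃ C', IsLoopFamily P a b c T' C' := by
  refine ⟨fun τ θ => pushPoints χ (a T) (b T) (a (max τ T)) (b (max τ T)) (C (min τ T) θ),
    ?_, ?_, ?_⟩
  · have hC' : ContinuousOn (fun p : ℝ × ℝ => C (min p.1 T) p.2) (Icc 0 T' ×ˢ univ) :=
      hC.continuousOn.comp (f := fun p : ℝ × ℝ => (min p.1 T, p.2)) (by fun_prop)
        fun p hp => ⟨⟨le_min hp.1.1 hT, min_le_right _ _⟩, trivial⟩
    have hχc := hχ.continuous
    unfold pushPoints
    refine hC'.add (ContinuousOn.add ?_ ?_)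
    · exact (hχc.comp_continuousOn (hC'.sub continuousOn_const)).smul (by fun_prop)
    · exact (hχc.comp_continuousOn (hC'.sub continuousOn_const)).smul (by fun_prop)
  · funext θ
    simp [hT, pushPoints_self, hC.start]
  · intro τ hτ
    rcases le_total τ T with h | h
    · simpa [h, pushPoints_self] using hC.avoiding τ ⟨hτ.1, h⟩
    · simpa [h] using (hC.avoiding T ⟨hT, le_rfl⟩).pushPoints hχ hχs hχ0 hχd (haT τ ⟨h, hτ.2⟩)
        (hbT τ ⟨h, hτ.2⟩) hab haP hbP

theorem exists_pos_le_norm_of_continuous {f : ℝ → ℂ} (hf : Continuous f) {s t : ℝ}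
    (h : ∀ τ ∈ Icc s t, f τ ≠ 0) : ∀ᶠ d in 𝓝[>] (0 : ℝ), ∀ τ ∈ Icc s t, d ≤ ‖f τ‖ := by
  rcases (Icc s t).eq_empty_or_nonempty with he | hne
  · simp [he]
  obtain ⟨x, hx, hmin⟩ := isCompact_Icc.exists_isMinOn hne hf.norm.continuousOn
  have hpos : 0 < ‖f x‖ := norm_pos_iff.2 (h x hx)
  filter_upwards [Ioc_mem_nhdsGT hpos] with d hd τ hτ
  exact hd.2.trans (hmin hτ)

/-- Two moving points which avoid a finite set, start together, and part, can be avoided by a loop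
which initially stays away from their starting point. -/
theorem exists_isLoopFamily {n : ℕ} (P : Fin n → ℂ) {a b : ℝ → ℂ} (ha : Continuous a)
    (hb : Continuous b) (hab0 : a 0 = b 0) (hab : ∀ τ ∈ Ioc (0 : ℝ) 1, a τ ≠ b τ)
    (haP : ∀ τ ∈ Icc (0 : ℝ) 1, ∀ j, a τ ≠ P j) (hbP : ∀ τ ∈ Icc (0 : ℝ) 1, ∀ j, b τ ≠ P j)
    {c : ℝ → ℂ} (hc : IsLoopAvoiding (range P) (a 0) (b 0) c) {ρ : ℝ} (hρ : 0 < ρ)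
    (hcρ : ∀ θ, ρ ≤ dist (c θ) (a 0)) : ∃ C, IsLoopFamily (range P) a b c 1 C := by
  obtain ⟨ε, hε, hεab⟩ : ∃ ε ∈ Ioc (0 : ℝ) 1, ∀ τ ∈ Icc 0 ε, dist (a τ) (a 0) < ρ ∧
      dist (b τ) (a 0) < ρ := by
    have h₁ := (ha.continuousAt (x := 0)).eventually (Metric.ball_mem_nhds (a 0) hρ)
    have h₂ := (hb.continuousAt (x := 0)).eventually (Metric.ball_mem_nhds (b 0) hρ)
    rw [← hab0] at h₂
    obtain ⟨δ, hδ, h⟩ := Metric.eventually_nhds_iff.1 (h₁.and h₂)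
    refine ⟨min (δ / 2) 1, ⟨by positivity, min_le_right _ _⟩, fun τ hτ => h ?_⟩
    rw [Real.dist_0_eq_abs, abs_of_nonneg hτ.1]
    linarith [hτ.2.trans (min_le_left _ _)]
  have hstart : IsLoopFamily (range P) a b c ε fun _ => c := by
    refine ⟨?_, rfl, fun τ hτ => { hc with ne_left := ?_, ne_right := ?_ }⟩
    · exact (hc.smooth.continuous.comp continuous_snd).continuousOn
    · rintro θ h
      exact (hcρ θ).not_gt (h ▸ (hεab τ hτ).1)
    · rintro θ h
      exact (hcρ θ).not_gt (h ▸ (hεab τ hτ).2)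
  obtain ⟨d, hd0, hdab, hdaP, hdbP⟩ : ∃ d > 0, (∀ τ ∈ Icc ε 1, d ≤ ‖a τ - b τ‖) ∧
      (∀ j, ∀ τ ∈ Icc ε 1, d ≤ ‖a τ - P j‖) ∧ (∀ j, ∀ τ ∈ Icc ε 1, d ≤ ‖b τ - P j‖) := by
    have h₁ := exists_pos_le_norm_of_continuous (s := ε) (t := 1) (ha.sub hb)
      fun τ hτ => sub_ne_zero.2 (hab τ ⟨hε.1.trans_le hτ.1, hτ.2⟩)
    have h₂ := eventually_all.2 fun j => exists_pos_le_norm_of_continuous (s := ε) (t := 1)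
      (ha.sub (continuous_const (y := P j)))
      fun τ hτ => sub_ne_zero.2 (haP τ ⟨hε.1.le.trans hτ.1, hτ.2⟩ j)
    have h₃ := eventually_all.2 fun j => exists_pos_le_norm_of_continuous (s := ε) (t := 1)
      (hb.sub (continuous_const (y := P j)))
      fun τ hτ => sub_ne_zero.2 (hbP τ ⟨hε.1.le.trans hτ.1, hτ.2⟩ j)
    obtain ⟨d, hd, h⟩ := (eventually_mem_nhdsWithin.and (h₁.and (h₂.and h₃))).exists
    exact ⟨d, hd, h⟩
  -- The same bump serves all steps, because `d` bounds all the relevant distances from below on the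
  -- whole of `[ε, 1]`. Its Lipschitz constant `L` then fixes how far a point may move in one step,
  -- and uniform continuity turns this into a step length.
  let f : ContDiffBump (0 : ℂ) := ⟨d / 2, d, by positivity, by linarith⟩
  have hfs : ContDiff ℝ ∞ f := f.contDiff
  obtain ⟨L, hL⟩ := hfs.lipschitzWith_of_hasCompactSupport f.hasCompactSupport (by simp)
  have hf0 : f 0 = 1 := f.one_of_mem_closedBall (by simp [f]; positivity)
  have hfd : ∀ z, d ≤ ‖z‖ → f z = 0 := fun z hz => f.zero_of_le_dist (by simpa [f] using hz)
  obtain ⟨δ, hδ, hδab⟩ : ∃ δ > 0, ∀ s ∈ Icc (0 : ℝ) 1, ∀ t ∈ Icc (0 : ℝ) 1, |t - s| < δ →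
      L * ‖a t - a s‖ ≤ 1 / 4 ∧ L * ‖b t - b s‖ ≤ 1 / 4 := by
    have key : ∀ g : ℝ → ℂ, Continuous g → ∃ δ > 0, ∀ s ∈ Icc (0 : ℝ) 1, ∀ t ∈ Icc (0 : ℝ) 1,
        |t - s| < δ → L * ‖g t - g s‖ ≤ 1 / 4 := by
      intro g hg
      have hu := isCompact_Icc.uniformContinuousOn_of_continuous
        (hg.continuousOn (s := Icc (0 : ℝ) 1))
      -- `L + 1` instead of `L`, since `L` may be zero.
      obtain ⟨δ, hδ, h⟩ := Metric.uniformContinuousOn_iff.1 hu (1 / (4 * (L + 1))) (by positivity)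
      refine ⟨δ, hδ, fun s hs t ht hst => ?_⟩
      have h₁ := (h t ht s hs hst).le
      rw [dist_eq_norm, le_div_iff₀ (by positivity)] at h₁
      nlinarith [norm_nonneg (g t - g s)]
    obtain ⟨δ₁, hδ₁, h₁⟩ := key a ha
    obtain ⟨δ₂, hδ₂, h₂⟩ := key b hb
    exact ⟨min δ₁ δ₂, lt_min hδ₁ hδ₂, fun s hs t ht hst =>
      ⟨h₁ s hs t ht (hst.trans_le (min_le_left _ _)),
        h₂ s hs t ht (hst.trans_le (min_le_right _ _))⟩⟩
  have step : ∀ n : ℕ, ∃ C, IsLoopFamily (range P) a b c (min (ε + n * (δ / 2)) 1) C := by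
    intro n
    induction n with
    | zero => exact ⟨_, by simpa [hε.2] using hstart⟩
    | succ n ih =>
      obtain ⟨C, hC⟩ := ih
      set T := min (ε + n * (δ / 2)) 1 with hT
      have hTε : ε ≤ T := le_min (by have := hδ.le; linarith [show 0 ≤ n * (δ / 2) by positivity]) hε.2
      have hT1 : T ∈ Icc ε 1 := ⟨hTε, min_le_right _ _⟩
      have hT0 : T ∈ Icc (0 : ℝ) 1 := ⟨hε.1.le.trans hTε, hT1.2⟩
      have hsmall : ∀ τ ∈ Icc T (min (ε + (n + 1 : ℕ) * (δ / 2)) 1),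
          τ ∈ Icc (0 : ℝ) 1 ∧ |τ - T| < δ := by
        intro τ hτ
        refine ⟨⟨hT0.1.trans hτ.1, hτ.2.trans (min_le_right _ _)⟩, ?_⟩
        rw [abs_of_nonneg (sub_nonneg.2 hτ.1)]
        have h₁ := hτ.2.trans (min_le_left _ _)
        have h₂ := hτ.2.trans (min_le_right _ _)
        push_cast at h₁
        rcases min_cases (ε + n * (δ / 2)) 1 with ⟨h, _⟩ | ⟨h, _⟩ <;> rw [← hT] at h <;> linarith
      refine hC.extend ha hb hT0.1 hL hfs hf0 hfd
        (fun τ hτ => (hδab T hT0 τ (hsmall τ hτ).1 (hsmall τ hτ).2).1)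
        (fun τ hτ => (hδab T hT0 τ (hsmall τ hτ).1 (hsmall τ hτ).2).2) (hdab T hT1) ?_ ?_
      · rintro _ ⟨j, rfl⟩
        exact hdaP j T hT1
      · rintro _ ⟨j, rfl⟩
        exact hdbP j T hT1
  obtain ⟨n, hn⟩ := exists_nat_ge (1 / (δ / 2))
  obtain ⟨C, hC⟩ := step n
  rw [div_le_iff₀ (by positivity)] at hn
  rw [min_eq_right (by linarith [hε.1])] at hC
  exact ⟨C, hC⟩

/-! ### The two real points of a complex point, and the lifted family of contours -/

theorem realPoint₁_eq (A : ℂ × ℂ) : realPoint₁ A = A.1 + Complex.I * A.2 := by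
  apply Complex.ext <;> simp [realPoint₁]; ring

theorem realPoint₂_eq (A : ℂ × ℂ) :
    realPoint₂ A = starRingEnd ℂ (A.1 - Complex.I * A.2) := by
  apply Complex.ext <;> simp [realPoint₂]; ring

theorem realPoint₁_ofPlane (z : ℂ) : realPoint₁ (ofPlane z) = z := by
  simp [realPoint₁, ofPlane]

theorem realPoint₂_ofPlane (z : ℂ) : realPoint₂ (ofPlane z) = z := by
  simp [realPoint₂, ofPlane]

theorem realPoint_ne {A : ℂ × ℂ} (hA : A ∉ realPlane) : realPoint₁ A ≠ realPoint₂ A := by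
  intro h
  simp only [realPoint₁, realPoint₂, Complex.mk.injEq] at h
  exact hA ⟨by linarith [h.2], by linarith [h.1]⟩

namespace SommerfeldSurface

variable {N M K : ℕ} {S : SommerfeldSurface N M K}

theorem realPoint₁_ne_of_notMem_T {A : ℂ × ℂ} (hA : A ∉ S.T) (j : Fin N) :
    realPoint₁ A ≠ S.P j := by
  intro h
  refine hA (mem_iUnion.2 ⟨j, Or.inl ?_⟩)
  change _ = _
  rw [← realPoint₁_eq, h, mul_comm, Complex.re_add_im]

theorem realPoint₂_ne_of_notMem_T {A : ℂ × ℂ} (hA : A ∉ S.T) (j : Fin N) :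
    realPoint₂ A ≠ S.P j := by
  intro h
  refine hA (mem_iUnion.2 ⟨j, Or.inr ?_⟩)
  change _ = _
  rw [realPoint₂_eq] at h
  rw [← Complex.conj_conj (A.1 - _), h]
  apply Complex.ext <;> simp

variable (S)

theorem existsUnique_lift {A : Type*} [TopologicalSpace A] [SimplyConnectedSpace A]
    [LocallyPathConnectedSpace A] [Nonempty (Fin M)] {f : A → ℂ} (hf : Continuous f)
    (hfP : ∀ x, f x ∉ S.branch) {x₀ : A} {p : S.Pt} (hp : p.base = f x₀) :
    ∃! F : C(A, S.Pt), F x₀ = p ∧ Pt.base ∘ F = f :=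
  S.isCoveringMapOn_base.existsUnique_continuousMap_lifts ⟨f, hf⟩ hp hfP

variable {S}

theorem lift_ext {A : Type*} [TopologicalSpace A] [SimplyConnectedSpace A]
    [LocallyPathConnectedSpace A] [Nonempty (Fin M)] {F G : A → S.Pt} (hF : Continuous F)
    (hG : Continuous G) (h : ∀ x, (F x).base = (G x).base) {x₀ : A} (h₀ : F x₀ = G x₀) : F = G := by
  have hb : Continuous fun x => (G x).base := S.continuous_base.comp hG
  obtain ⟨H, -, hH⟩ := S.existsUnique_lift hb (fun x => (G x).base_notMem_branch)
    (x₀ := x₀) (p := G x₀) rfl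
  have h₁ := hH ⟨F, hF⟩ ⟨h₀, funext h⟩
  have h₂ := hH ⟨G, hG⟩ ⟨rfl, rfl⟩
  exact congrArg DFunLike.coe (h₁.trans h₂.symm)

theorem exists_isContourFamily {A₀ : S.Pt} {σ : ℝ → ℂ × ℂ} (hσ : ContinuousOn σ (Icc 0 1))
    (hσ₀ : σ 0 = ofPlane A₀.base) (hσT : ∀ τ ∈ Ioc (0 : ℝ) 1, σ τ ∉ S.T ∪ realPlane)
    {γ : ℝ → S.Pt} (hγ : S.IsSmallBoundary A₀ γ) : ∃ Γ, S.IsContourFamily σ γ Γ := by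
  have : Nonempty (Fin M) := ⟨A₀.sheet⟩
  -- Freezing `σ` outside `[0, 1]` makes the two moving points continuous on all of `ℝ`.
  set σ' : ℝ → ℂ × ℂ := fun τ => σ (projIcc 0 1 zero_le_one τ) with hσ'
  have hσ'c : Continuous σ' :=
    (hσ.comp_continuous (continuous_subtype_val.comp continuous_projIcc) fun τ => (Subtype.prop _))
  have hσσ' : ∀ τ ∈ Icc (0 : ℝ) 1, σ' τ = σ τ := fun τ hτ => by
    simp [hσ', projIcc_of_mem _ hτ]
  have h0 : (0 : ℝ) ∈ Icc (0 : ℝ) 1 := ⟨le_rfl, zero_le_one⟩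
  have hP : ∀ τ ∈ Icc (0 : ℝ) 1, ∀ j, realPoint₁ (σ' τ) ≠ S.P j ∧ realPoint₂ (σ' τ) ≠ S.P j := by
    intro τ hτ j
    rw [hσσ' τ hτ]
    rcases hτ.1.eq_or_lt with rfl | h
    · rw [hσ₀, realPoint₁_ofPlane, realPoint₂_ofPlane]
      exact ⟨A₀.base_ne j, A₀.base_ne j⟩
    · have := hσT τ ⟨h, hτ.2⟩
      exact ⟨realPoint₁_ne_of_notMem_T (fun h => this (Or.inl h)) j,
        realPoint₂_ne_of_notMem_T (fun h => this (Or.inl h)) j⟩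
  have hr₁ : Continuous fun τ => realPoint₁ (σ' τ) := by
    simp only [realPoint₁_eq]; fun_prop
  have hr₂ : Continuous fun τ => realPoint₂ (σ' τ) := by
    simp only [realPoint₂_eq]; exact Complex.continuous_conj.comp (by fun_prop)
  have hr₁0 : realPoint₁ (σ' 0) = A₀.base := by rw [hσσ' 0 h0, hσ₀, realPoint₁_ofPlane]
  have hr₂0 : realPoint₂ (σ' 0) = A₀.base := by rw [hσσ' 0 h0, hσ₀, realPoint₂_ofPlane]
  obtain ⟨U, hU, hAU, -, hinj, hfr⟩ := hγ.boundary
  -- The contour is the frontier of the open set `U`, so it misses `A₀`; injectivity of `ψ` on the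
  -- closure makes its projection miss `ψ(A₀)`.
  have hne : ∀ θ, (γ θ).base ≠ A₀.base := by
    intro θ h
    have hθ : γ θ ∈ frontier U := hfr ▸ mem_range_self θ
    have := hinj (frontier_subset_closure hθ) (subset_closure hAU) h
    rw [this, frontier, hU.interior_eq] at hθ
    exact hθ.2 hAU
  have hγc := hγ.isContour
  have hbc : Continuous fun θ => (γ θ).base := hγc.smooth.continuous
  obtain ⟨ρ, hρ, hρd⟩ : ∃ ρ > 0, ∀ θ, ρ ≤ dist (γ θ).base A₀.base := by
    obtain ⟨θ₀, -, hmin⟩ := isCompact_Icc.exists_isMinOn (nonempty_Icc.2 (zero_le_one (α := ℝ)))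
      (hbc.dist (continuous_const (y := A₀.base))).continuousOn
    refine ⟨dist (γ θ₀).base A₀.base, dist_pos.2 (hne θ₀), fun θ => ?_⟩
    obtain ⟨θ', hθ', h⟩ := hγc.periodic.exists_mem_Ico₀ one_pos θ
    rw [h]
    exact hmin (Ico_subset_Icc_self hθ')
  have hloop : IsLoopAvoiding (range S.P) (realPoint₁ (σ' 0)) (realPoint₂ (σ' 0))
      fun θ => (γ θ).base := by
    refine ⟨hγc.smooth, fun θ => ?_, hγc.velocity_ne_zero, fun θ => (γ θ).base_notMem_branch,
      fun θ => ?_, fun θ => ?_⟩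
    · simp only [hγc.periodic θ]
    · rw [hr₁0]; exact hne θ
    · rw [hr₂0]; exact hne θ
  obtain ⟨C, hC⟩ := exists_isLoopFamily S.P hr₁ hr₂ (hr₁0.trans hr₂0.symm)
    (fun τ hτ => by
      rw [hσσ' τ (Ioc_subset_Icc_self hτ)]
      exact realPoint_ne fun h => hσT τ hτ (Or.inr h))
    (fun τ hτ j => (hP τ hτ j).1) (fun τ hτ j => (hP τ hτ j).2) hloop hρ
    (fun θ => by rw [hr₁0]; exact hρd θ)
  set H : ℝ × ℝ → ℂ := fun p => C (projIcc 0 1 zero_le_one p.1) p.2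
  have hH : Continuous H := by
    refine hC.continuousOn.comp_continuous
      (f := fun p : ℝ × ℝ => ((projIcc (0 : ℝ) 1 zero_le_one p.1 : ℝ), p.2)) ?_
      fun p => ⟨Subtype.prop _, trivial⟩
    exact (continuous_subtype_val.comp (continuous_projIcc.comp continuous_fst)).prodMk
      continuous_snd
  have hav : ∀ p, IsLoopAvoiding (range S.P) _ _ (C (projIcc (0 : ℝ) 1 zero_le_one p)) :=
    fun p => hC.avoiding _ (Subtype.prop _)
  have hH0 : ∀ θ, H (0, θ) = (γ θ).base := fun θ => by simp [H, hC.start]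
  obtain ⟨F, ⟨hF0, hF⟩, -⟩ := S.existsUnique_lift hH (fun p => (hav p.1).notMem p.2)
    (x₀ := (0, 0)) (p := γ 0) (hH0 0).symm
  have hFb : ∀ τ θ, (F (τ, θ)).base = H (τ, θ) := fun τ θ => congrFun hF (τ, θ)
  have hstart : (fun θ => F (0, θ)) = γ :=
    lift_ext (x₀ := 0) (by fun_prop) hγc.continuous (fun θ => by rw [hFb, hH0]) hF0
  -- The shift of the lift by one period lifts the same planar homotopy and agrees with it at `(0,
  -- 0)`, where `γ` closes up. Uniqueness of lifts keeps every intermediate contour closed.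
  have hper : (fun p : ℝ × ℝ => F (p.1, p.2 + 1)) = F := by
    refine lift_ext (x₀ := (0, 0)) (by fun_prop) F.continuous (fun p => ?_) ?_
    · rw [hFb, ← Prod.mk.eta (p := p), hFb]
      exact (hav p.1).periodic p.2
    · have := congrFun hstart
      simp only at this ⊢
      rw [this, this]
      exact hγc.periodic 0
  have hbase : ∀ τ ∈ Icc (0 : ℝ) 1, (fun θ => (F (τ, θ)).base) = C τ := by
    intro τ hτ
    funext θ
    rw [hFb]
    simp [H, projIcc_of_mem _ hτ]
  refine ⟨fun τ θ => F (τ, θ), fun τ hτ => ⟨by fun_prop, fun θ => congrFun hper (τ, θ), ?_, ?_⟩,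
    F.continuous.continuousOn, hstart, fun τ hτ => ?_, fun τ hτ => ?_⟩
  · rw [hbase τ hτ]; exact (hC.avoiding τ hτ).smooth
  · rw [hbase τ hτ]; exact (hC.avoiding τ hτ).velocity_ne_zero
  · rintro ⟨_, ⟨θ, rfl⟩, h⟩
    rw [← hσσ' τ hτ] at h
    exact (hC.avoiding τ hτ).ne_left θ ((congrFun (hbase τ hτ) θ).symm.trans h)
  · rintro ⟨_, ⟨θ, rfl⟩, h⟩
    rw [← hσσ' τ hτ] at h
    exact (hC.avoiding τ hτ).ne_right θ ((congrFun (hbase τ hτ) θ).symm.trans h)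

end SommerfeldSurface

/-! ### Osgood's lemma through Cauchy's formula on a torus -/

open BoundedContinuousFunction in
/-- Integration over `[0, 2π]²` against a continuous density. -/
theorem exists_clm_integral_square {G : ℝ × ℝ → ℂ} (hG : Continuous G) :
    ∃ l : BoundedContinuousFunction (ℝ × ℝ) ℂ →L[ℂ] ℂ, ∀ φ, l φ =
      ∫ s in (0 : ℝ)..2 * Real.pi, ∫ t in (0 : ℝ)..2 * Real.pi, φ (s, t) * G (s, t) := by
  obtain ⟨B, hB⟩ := (isCompact_Icc (a := ((0 : ℝ), (0 : ℝ)))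
    (b := (2 * Real.pi, 2 * Real.pi))).exists_bound_of_continuousOn hG.continuousOn
  have hpi : (0 : ℝ) ≤ 2 * Real.pi := by positivity
  have hin : ∀ φ : BoundedContinuousFunction (ℝ × ℝ) ℂ, ∀ s,
      IntervalIntegrable (fun t => φ (s, t) * G (s, t)) MeasureTheory.volume 0 (2 * Real.pi) :=
    fun φ s => Continuous.intervalIntegrable (by fun_prop) _ _
  have hout : ∀ φ : BoundedContinuousFunction (ℝ × ℝ) ℂ,
      IntervalIntegrable (fun s => ∫ t in (0 : ℝ)..2 * Real.pi, φ (s, t) * G (s, t))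
        MeasureTheory.volume 0 (2 * Real.pi) := by
    intro φ
    refine Continuous.intervalIntegrable ?_ _ _
    exact intervalIntegral.continuous_parametric_intervalIntegral_of_continuous'
      (f := fun s t => φ (s, t) * G (s, t)) (by fun_prop) _ _
  refine ⟨LinearMap.mkContinuous
    { toFun := fun φ => ∫ s in (0 : ℝ)..2 * Real.pi, ∫ t in (0 : ℝ)..2 * Real.pi,
        φ (s, t) * G (s, t)
      map_add' := fun φ ψ => ?_
      map_smul' := fun c φ => ?_ } ((B * (2 * Real.pi)) * (2 * Real.pi)) ?_, fun φ => rfl⟩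
  · rw [← intervalIntegral.integral_add (hout φ) (hout ψ)]
    refine intervalIntegral.integral_congr fun s _ => ?_
    rw [← intervalIntegral.integral_add (hin φ s) (hin ψ s)]
    refine intervalIntegral.integral_congr fun t _ => ?_
    simp [add_mul]
  · simp only [BoundedContinuousFunction.coe_smul, smul_eq_mul, mul_assoc,
      intervalIntegral.integral_const_mul, RingHom.id_apply]
  · intro φ
    have h₁ : ∀ s ∈ Icc 0 (2 * Real.pi), ‖∫ t in (0 : ℝ)..2 * Real.pi, φ (s, t) * G (s, t)‖ ≤
        ‖φ‖ * B * |2 * Real.pi - 0| := by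
      intro s hs
      refine intervalIntegral.norm_integral_le_of_norm_le_const fun t ht => ?_
      rw [uIoc_of_le hpi] at ht
      rw [norm_mul]
      exact mul_le_mul (φ.norm_coe_le_norm _) (hB _ ⟨⟨hs.1, ht.1.le⟩, ⟨hs.2, ht.2⟩⟩)
        (norm_nonneg _) (norm_nonneg _)
    have h₂ := intervalIntegral.norm_integral_le_of_norm_le_const (a := 0) (b := 2 * Real.pi)
      (f := fun s => ∫ t in (0 : ℝ)..2 * Real.pi, φ (s, t) * G (s, t)) fun s hs => by
        rw [uIoc_of_le hpi] at hs
        exact h₁ s (Ioc_subset_Icc_self hs)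
    simp only [LinearMap.coe_mk, AddHom.coe_mk]
    rw [sub_zero, abs_of_nonneg hpi] at h₂
    linarith

/-- The function `1 / (c - z)` is analytic in `z` as a bounded function, if `c` stays away
from the centre. -/
theorem exists_analyticAt_inv_sub {X : Type*} [TopologicalSpace X] {c : X → ℂ} (hc : Continuous c)
    {z₀ : ℂ} {r : ℝ} (hr : 0 < r) (hcr : ∀ x, ‖c x - z₀‖ = r) :
    ∃ k : ℂ → BoundedContinuousFunction X ℂ, AnalyticAt ℂ k z₀ ∧
      ∀ᶠ z in 𝓝 z₀, ∀ x, k z x = (c x - z)⁻¹ := by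
  let b : BoundedContinuousFunction X ℂ := BoundedContinuousFunction.ofNormedAddCommGroup c hc
    (r + ‖z₀‖) fun x => by
      have := norm_add_le (c x - z₀) z₀
      rwa [sub_add_cancel, hcr] at this
  have hne : ∀ x, c x - z₀ ≠ 0 := fun x h => by
    have := hcr x
    rw [h, norm_zero] at this
    exact hr.ne this
  let i : BoundedContinuousFunction X ℂ := BoundedContinuousFunction.ofNormedAddCommGroup
    (fun x => (c x - z₀)⁻¹) ((hc.sub continuous_const).inv₀ hne) r⁻¹ fun x => by
      rw [norm_inv, hcr]
  -- `c - z` depends affinely on `z` in the Banach algebra of bounded continuous functions and is a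
  -- unit at `z₀`. Inversion is analytic near units.
  let a : ℂ → BoundedContinuousFunction X ℂ := fun z => b - algebraMap ℂ _ z
  have ha : ∀ z x, a z x = c x - z := fun z x => by
    change c x - (algebraMap ℂ (BoundedContinuousFunction X ℂ) z) x = _
    rw [BoundedContinuousFunction.algebraMap_apply]
    simp
  have hab : a z₀ * i = 1 := by
    ext x
    simp only [BoundedContinuousFunction.coe_mul, Pi.mul_apply, ha]
    exact mul_inv_cancel₀ (hne x)
  let u : (BoundedContinuousFunction X ℂ)ˣ := ⟨a z₀, i, hab, by rw [mul_comm]; exact hab⟩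
  have haa : AnalyticAt ℂ a z₀ := by
    refine analyticAt_const.sub ?_
    exact (Algebra.linearMap ℂ (BoundedContinuousFunction X ℂ)).mkContinuousOfExistsBound
      ⟨‖(1 : BoundedContinuousFunction X ℂ)‖, fun z => by
        rw [Algebra.linearMap_apply, Algebra.algebraMap_eq_smul_one, norm_smul, mul_comm]⟩
      |>.analyticAt z₀
  refine ⟨fun z => Ring.inverse (a z), ?_, ?_⟩
  · exact AnalyticAt.comp (g := Ring.inverse) (f := a) (analyticAt_inverse (𝕜 := ℂ) u) haa
  · have hu : ∀ᶠ z in 𝓝 z₀, IsUnit (a z) :=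
      haa.continuousAt.eventually (Units.isOpen.mem_nhds u.isUnit)
    filter_upwards [hu] with z hz x
    have h := congrArg (fun f : BoundedContinuousFunction X ℂ => f x) (Ring.mul_inverse_cancel _ hz)
    simp only [BoundedContinuousFunction.coe_mul, Pi.mul_apply, ha] at h
    exact eq_inv_of_mul_eq_one_right h

/-- Osgood's lemma: a function of two complex variables which is complex differentiable near a
point is analytic there. -/
theorem Complex.analyticAt_prod_of_eventually_differentiableAt {f : ℂ × ℂ → ℂ} {x₀ : ℂ × ℂ}
    (h : ∀ᶠ x in 𝓝 x₀, DifferentiableAt ℂ f x) : AnalyticAt ℂ f x₀ := by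
  obtain ⟨z₀, w₀⟩ := x₀
  obtain ⟨r, hr, hf⟩ := Metric.nhds_basis_closedBall.eventually_iff.1 h
  have hf : ∀ z ∈ Metric.closedBall z₀ r, ∀ w ∈ Metric.closedBall w₀ r,
      DifferentiableAt ℂ f (z, w) := fun z hz w hw => hf (by
    rw [← closedBall_prod_same]; exact ⟨hz, hw⟩)
  have hcm : ∀ (c : ℂ) (θ : ℝ), circleMap c r θ ∈ Metric.closedBall c r := fun c θ =>
    circleMap_mem_closedBall c hr.le θ
  set κ : ℂ := (2 * Real.pi * Complex.I)⁻¹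
  set G : ℝ × ℝ → ℂ := fun θ => κ * κ * (deriv (circleMap z₀ r) θ.1 * deriv (circleMap w₀ r) θ.2 *
    f (circleMap z₀ r θ.1, circleMap w₀ r θ.2))
  have hG : Continuous G := by
    have h₁ : Continuous fun θ : ℝ × ℝ => f (circleMap z₀ r θ.1, circleMap w₀ r θ.2) := by
      refine continuous_iff_continuousAt.2 fun θ => ?_
      refine ContinuousAt.comp (f := fun θ : ℝ × ℝ => (circleMap z₀ r θ.1, circleMap w₀ r θ.2))
        (hf _ (hcm z₀ θ.1) _ (hcm w₀ θ.2)).continuousAt ?_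
      exact (((continuous_circleMap z₀ r).comp continuous_fst).prodMk
        ((continuous_circleMap w₀ r).comp continuous_snd)).continuousAt
    have h₂ : Continuous fun θ : ℝ × ℝ =>
        deriv (circleMap z₀ r) θ.1 * deriv (circleMap w₀ r) θ.2 := by
      simp only [deriv_circleMap]
      fun_prop
    exact continuous_const.mul (h₂.mul h₁)
  -- The double Cauchy integral is a fixed continuous functional `l` applied to the product of two
  -- Cauchy kernels, each analytic in one variable with values in bounded functions. Analyticity of
  -- the integral is then a composition, with no power series to sum.
  obtain ⟨l, hl⟩ := exists_clm_integral_square hG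
  obtain ⟨k₁, hk₁, hk₁'⟩ := exists_analyticAt_inv_sub (X := ℝ × ℝ) (z₀ := z₀) (r := r)
    ((continuous_circleMap z₀ r).comp continuous_fst) hr
    (fun θ => by simp [circleMap, abs_of_pos hr])
  obtain ⟨k₂, hk₂, hk₂'⟩ := exists_analyticAt_inv_sub (X := ℝ × ℝ) (z₀ := w₀) (r := r)
    ((continuous_circleMap w₀ r).comp continuous_snd) hr
    (fun θ => by simp [circleMap, abs_of_pos hr])
  have han : AnalyticAt ℂ (fun x : ℂ × ℂ => l (k₁ x.1 * k₂ x.2)) (z₀, w₀) := by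
    refine (l.analyticAt _).comp (AnalyticAt.mul ?_ ?_)
    · exact AnalyticAt.comp (f := Prod.fst) (x := (z₀, w₀)) hk₁ analyticAt_fst
    · exact AnalyticAt.comp (f := Prod.snd) (x := (z₀, w₀)) hk₂ analyticAt_snd
  refine han.congr ?_
  have e₁ := (continuous_fst.tendsto (z₀, w₀)).eventually
    (hk₁'.and (Metric.ball_mem_nhds z₀ hr))
  have e₂ := (continuous_snd.tendsto (z₀, w₀)).eventually
    (hk₂'.and (Metric.ball_mem_nhds w₀ hr))
  filter_upwards [e₁, e₂] with x h₁ h₂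
  obtain ⟨z, w⟩ := x
  simp only at h₁ h₂
  have cauchy : ∀ (g : ℂ → ℂ) (c v : ℂ), v ∈ Metric.ball c r →
      (∀ y ∈ Metric.closedBall c r, DifferentiableAt ℂ g y) →
      κ * ∮ y in C(c, r), (y - v)⁻¹ * g y = g v := by
    intro g c v hv hg
    have hd : DiffContOnCl ℂ g (Metric.ball c r) := by
      refine DifferentiableOn.diffContOnCl fun y hy => ?_
      rw [closure_ball c hr.ne'] at hy
      exact (hg y hy).differentiableWithinAt
    exact hd.two_pi_i_inv_smul_circleIntegral_sub_inv_smul hv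
  have hz : ∀ v ∈ Metric.closedBall w₀ r, ∀ y ∈ Metric.closedBall z₀ r,
      DifferentiableAt ℂ (fun y => f (y, v)) y := fun v hv y hy =>
    (hf y hy v hv).comp (f := fun y => (y, v)) y (by fun_prop)
  have hw : ∀ v ∈ Metric.closedBall z₀ r, ∀ y ∈ Metric.closedBall w₀ r,
      DifferentiableAt ℂ (fun y => f (v, y)) y := fun v hv y hy =>
    (hf v hv y hy).comp (f := fun y => (v, y)) y (by fun_prop)
  rw [hl, ← cauchy (fun y => f (y, w)) z₀ z h₁.2 (hz w (Metric.ball_subset_closedBall h₂.2))]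
  rw [circleIntegral, ← intervalIntegral.integral_const_mul]
  refine intervalIntegral.integral_congr fun s _ => ?_
  simp only [smul_eq_mul]
  rw [← cauchy (fun y => f (circleMap z₀ r s, y)) w₀ w h₂.2 (hw _ (hcm z₀ s)), circleIntegral,
    ← intervalIntegral.integral_const_mul, ← intervalIntegral.integral_const_mul,
    ← intervalIntegral.integral_const_mul, ← intervalIntegral.integral_const_mul]
  refine intervalIntegral.integral_congr fun t _ => ?_
  simp only [smul_eq_mul, BoundedContinuousFunction.coe_mul, Pi.mul_apply, h₁.1, h₂.1, G,
    Function.comp_apply]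
  ring

/-! ### The Riemann function of the mixed equation -/

/-- On the ball of radius `R = ‖q‖ + 1`, the bound `n ≤ 2 ^ n` dominates the differentiated terms by
`(2 C R) ^ n / n!`, so the series may be differentiated termwise. -/
theorem Complex.hasDerivAt_tsum_pow {a : ℕ → ℂ} {C : ℝ}
    (ha : ∀ n, ‖a n‖ ≤ C ^ n / n.factorial) (q : ℂ) :
    HasDerivAt (fun q => ∑' n, a n * q ^ n) (∑' n, (n + 1) * a (n + 1) * q ^ n) q := by
  have hC0 : 0 ≤ C := by simpa using (norm_nonneg _).trans (ha 1)
  set R : ℝ := ‖q‖ + 1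
  have hR : 1 ≤ R := by simp [R]
  have hq : q ∈ Metric.ball (0 : ℂ) R := by simp [R]
  have hsum := Real.summable_pow_div_factorial (2 * C * R)
  have hbound : ∀ (n : ℕ), ∀ y ∈ Metric.ball (0 : ℂ) R,
      ‖a n * (n * y ^ (n - 1))‖ ≤ (2 * C * R) ^ n / n.factorial := by
    intro n y hy
    rw [norm_mul, norm_mul, norm_pow, Complex.norm_natCast]
    have h₁ : ‖y‖ ^ (n - 1) ≤ R ^ n := by
      refine (pow_le_pow_left₀ (norm_nonneg _) (by simpa using hy : ‖y‖ < R).le _).trans ?_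
      exact pow_le_pow_right₀ hR (Nat.sub_le _ _)
    have h₂ : (n : ℝ) ≤ 2 ^ n := by exact_mod_cast Nat.lt_two_pow_self.le
    calc ‖a n‖ * (n * ‖y‖ ^ (n - 1)) ≤ C ^ n / n.factorial * (2 ^ n * R ^ n) := by
          gcongr
          exact ha n
      _ = (2 * C * R) ^ n / n.factorial := by rw [mul_pow, mul_pow]; ring
  refine (hasDerivAt_tsum_of_isPreconnected (g := fun n q => a n * q ^ n)
    (g' := fun n q => a n * (n * q ^ (n - 1))) (y₀ := 0) (y := q) hsum Metric.isOpen_ball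
    (convex_ball (0 : ℂ) R).isPreconnected
    (fun n y _ => (hasDerivAt_pow n y).const_mul (a n)) hbound
    (Metric.mem_ball_self (by positivity)) ?_ hq).congr_deriv ?_
  · refine summable_of_ne_finset_zero (s := {0}) fun n hn => ?_
    simp [zero_pow (by simpa using hn : n ≠ 0)]
  · have hs : Summable fun n : ℕ => a n * (n * q ^ (n - 1)) :=
      Summable.of_norm_bounded hsum fun n => hbound n q hq
    rw [hs.tsum_eq_zero_add]
    simp only [CharP.cast_eq_zero, zero_mul, mul_zero, zero_add, Nat.add_sub_cancel]
    refine tsum_congr fun n => ?_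
    push_cast
    ring

/-- The entire solution of `(q J')' = c J`, `J(0) = 1`; it is `J₀(2 √(-c q))`. -/
theorem exists_entire_besselClifford (c : ℂ) : ∃ J : ℂ → ℂ, Differentiable ℂ J ∧ J 0 = 1 ∧
    ∀ q, deriv J q + q * deriv (deriv J) q = c * J q := by
  set a : ℕ → ℂ := fun n => c ^ n / (n.factorial : ℂ) ^ 2
  have hfac : ∀ n : ℕ, (1 : ℝ) ≤ n.factorial := fun n => by
    exact_mod_cast Nat.one_le_iff_ne_zero.2 (Nat.factorial_ne_zero n)
  have ha : ∀ n, ‖a n‖ ≤ ‖c‖ ^ n / n.factorial := fun n => by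
    simp only [a, norm_div, norm_pow, Complex.norm_natCast]
    have := hfac n
    gcongr
    nlinarith
  have hb : ∀ n : ℕ, ‖(n : ℂ) * a n‖ ≤ (2 * ‖c‖) ^ n / n.factorial := fun n => by
    rw [norm_mul, Complex.norm_natCast, mul_pow, mul_div_assoc]
    have h₂ : (n : ℝ) ≤ 2 ^ n := by exact_mod_cast Nat.lt_two_pow_self.le
    have := ha n
    gcongr
  have h₁ := Complex.hasDerivAt_tsum_pow ha
  have h₂ := Complex.hasDerivAt_tsum_pow hb
  set J : ℂ → ℂ := fun q => ∑' n, a n * q ^ n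
  have hJ : Differentiable ℂ J := fun q => (h₁ q).differentiableAt
  have hJ' : Differentiable ℂ (deriv J) :=
    (hJ.contDiff (n := 2)).differentiable_deriv_two
  refine ⟨J, hJ, ?_, fun q => ?_⟩
  · simp only [J]
    rw [tsum_eq_single 0 fun n hn => by simp [hn]]
    simp [a]
  -- The left side of the equation is `(q J')'`. Since `q J' = ∑ n aₙ qⁿ`, its derivative has the
  -- coefficients `(n + 1)² aₙ₊₁ = c aₙ`.
  · have e : (fun q => ∑' n : ℕ, (n : ℂ) * a n * q ^ n) = fun q => q * deriv J q := by
      funext q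
      rw [(h₁ q).deriv, ← tsum_mul_left]
      have hs : Summable fun n : ℕ => (n : ℂ) * a n * q ^ n := by
        refine Summable.of_norm_bounded (Real.summable_pow_div_factorial (2 * ‖c‖ * ‖q‖))
          fun n => ?_
        rw [norm_mul, norm_pow, mul_pow _ ‖q‖, mul_div_right_comm]
        have := hb n
        gcongr
      rw [hs.tsum_eq_zero_add]
      simp only [CharP.cast_eq_zero, zero_mul, zero_add]
      refine tsum_congr fun n => ?_
      push_cast
      ring
    have h₃ := h₂ q
    rw [e] at h₃
    have h₄ := ((hasDerivAt_id q).mul (hJ' q).hasDerivAt).unique h₃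
    simp only [id, one_mul] at h₄
    rw [h₄, ← tsum_mul_left]
    refine tsum_congr fun n => ?_
    have : (n.factorial : ℂ) ≠ 0 := by exact_mod_cast Nat.factorial_ne_zero n
    have : (n + 1 : ℂ) ≠ 0 := by exact_mod_cast Nat.succ_ne_zero n
    simp only [a, Nat.factorial_succ]
    push_cast
    field_simp
    ring

section DirDeriv

variable {E : Type*} [NormedAddCommGroup E] [NormedSpace ℂ E]

/-- The derivative in a fixed direction. -/
noncomputable def dirDeriv (v : E) (f : E → ℂ) : E → ℂ := fun x => fderiv ℂ f x v

theorem ContDiff.dirDeriv {f : E → ℂ} (hf : ContDiff ℂ ∞ f) (v : E) :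
    ContDiff ℂ ∞ (dirDeriv v f) :=
  (hf.fderiv_right (m := ∞) (by simp)).clm_apply contDiff_const

theorem fderiv_fderiv_apply {f : E → ℂ} {x : E} (hf : DifferentiableAt ℂ (fderiv ℂ f) x)
    (v w : E) : fderiv ℂ (dirDeriv v f) x w = fderiv ℂ (fderiv ℂ f) x w v := by
  have : dirDeriv v f = fun y => fderiv ℂ f y v := rfl
  rw [this, fderiv_clm_apply hf (differentiableAt_const v)]
  simp

theorem dirDeriv_comm {f : E → ℂ} (hf : ContDiff ℂ ∞ f) (v w : E) :
    dirDeriv v (dirDeriv w f) = dirDeriv w (dirDeriv v f) := by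
  funext x
  have hd : DifferentiableAt ℂ (fderiv ℂ f) x :=
    ((hf.fderiv_right (m := ∞) (by simp)).differentiable (by simp)) x
  have hs : IsSymmSndFDerivAt ℂ f x := hf.contDiffAt.isSymmSndFDerivAt (by
    simpa using (WithTop.coe_le_coe.2 le_top : ((2 : ℕ∞) : WithTop ℕ∞) ≤ ∞))
  change fderiv ℂ (dirDeriv w f) x v = fderiv ℂ (dirDeriv v f) x w
  rw [fderiv_fderiv_apply hd, fderiv_fderiv_apply hd, hs]

theorem dirDeriv_const_mul {f : E → ℂ} (hf : ContDiff ℂ ∞ f) (c : ℂ) (v : E) :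
    dirDeriv v (fun x => c * f x) = fun x => c * dirDeriv v f x := by
  funext x
  simp only [dirDeriv]
  rw [fderiv_const_mul (hf.differentiable (by simp) x)]
  simp

theorem dirDeriv_neg (f : E → ℂ) (v : E) :
    dirDeriv v (fun x => -f x) = fun x => -dirDeriv v f x := by
  funext x
  simp [dirDeriv, fderiv_fun_neg]

/-- A function which is constant along a line has a vanishing derivative in its direction. -/
theorem dirDeriv_eq_zero_of_const {f : E → ℂ} {x : E} (hf : DifferentiableAt ℂ f x) {v : E} {b : ℂ}
    (h : ∀ t : ℂ, f (x + t • v) = b) : dirDeriv v f x = 0 := by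
  have h₁ : HasDerivAt (fun t : ℂ => x + t • v) v 0 := by
    simpa using ((hasDerivAt_id (0 : ℂ)).smul_const v).const_add x
  have hf' : HasFDerivAt f (fderiv ℂ f x) (x + (0 : ℂ) • v) := by simpa using hf.hasFDerivAt
  have h₂ := hf'.comp_hasDerivAt (0 : ℂ) h₁
  have h₃ : f ∘ (fun t : ℂ => x + t • v) = fun _ => b := funext h
  rw [h₃] at h₂
  exact h₂.unique (hasDerivAt_const _ _)

end DirDeriv

/-- The `z`-direction in the space of the `((z, w), (ζ, η))`. -/
def dirZ : (ℂ × ℂ) × (ℂ × ℂ) := ((1, 0), (0, 0))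
/-- The `w`-direction. -/
def dirW : (ℂ × ℂ) × (ℂ × ℂ) := ((0, 1), (0, 0))
/-- The `ζ`-direction. -/
def dirZeta : (ℂ × ℂ) × (ℂ × ℂ) := ((0, 0), (1, 0))
/-- The `η`-direction. -/
def dirEta : (ℂ × ℂ) × (ℂ × ℂ) := ((0, 0), (0, 1))

/-- A kernel which solves `∂_ζ ∂_η K = c K` in its second pair of variables. -/
structure IsHelmholtzKernel (c : ℂ) (K : (ℂ × ℂ) × (ℂ × ℂ) → ℂ) : Prop where
  contDiff : ContDiff ℂ ∞ K
  eqn : dirDeriv dirZeta (dirDeriv dirEta K) = fun y => c * K y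

/-- The equation has constant coefficients, so it commutes with directional derivatives. This lets
the derivatives of `R` in `z` and `w` serve as kernels in turn. -/
theorem IsHelmholtzKernel.dirDeriv {c : ℂ} {K : (ℂ × ℂ) × (ℂ × ℂ) → ℂ}
    (hK : IsHelmholtzKernel c K) (v : (ℂ × ℂ) × (ℂ × ℂ)) : IsHelmholtzKernel c (dirDeriv v K) := by
  refine ⟨hK.contDiff.dirDeriv v, ?_⟩
  rw [dirDeriv_comm hK.contDiff, dirDeriv_comm (hK.contDiff.dirDeriv _), hK.eqn,
    dirDeriv_const_mul hK.contDiff]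

/-- The Riemann function of the operator `∂_z ∂_w - c`. -/
structure IsRiemannFunction (c : ℂ) (R : (ℂ × ℂ) × (ℂ × ℂ) → ℂ) : Prop
    extends IsHelmholtzKernel c R where
  dirZ_eq : dirDeriv dirZ R = fun y => -dirDeriv dirZeta R y
  dirW_eq : dirDeriv dirW R = fun y => -dirDeriv dirEta R y
  eq_one_left : ∀ z w η, R ((z, w), (z, η)) = 1
  eq_one_right : ∀ z w ζ, R ((z, w), (ζ, w)) = 1

/-- `R = J(q)` with `q = (z - ζ)(w - η)`. Dependence on differences alone gives the sign rules, `q =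
0` on both characteristics gives the value 1, and `∂_ζ ∂_η J(q) = J' + q J''` reduces the equation
to that of `J`. -/
theorem exists_isRiemannFunction (c : ℂ) : ∃ R, IsRiemannFunction c R := by
  obtain ⟨J, hJ, hJ0, hJc⟩ := exists_entire_besselClifford c
  have hJ' : Differentiable ℂ (deriv J) :=
    (hJ.contDiff (n := 2)).differentiable_deriv_two
  let L₁ : (ℂ × ℂ) × (ℂ × ℂ) →L[ℂ] ℂ :=
    (ContinuousLinearMap.fst ℂ ℂ ℂ).comp
      (ContinuousLinearMap.fst ℂ (ℂ × ℂ) (ℂ × ℂ) - ContinuousLinearMap.snd ℂ (ℂ × ℂ) (ℂ × ℂ))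
  let L₂ : (ℂ × ℂ) × (ℂ × ℂ) →L[ℂ] ℂ :=
    (ContinuousLinearMap.snd ℂ ℂ ℂ).comp
      (ContinuousLinearMap.fst ℂ (ℂ × ℂ) (ℂ × ℂ) - ContinuousLinearMap.snd ℂ (ℂ × ℂ) (ℂ × ℂ))
  set q : (ℂ × ℂ) × (ℂ × ℂ) → ℂ := fun y => (y.1.1 - y.2.1) * (y.1.2 - y.2.2) with hq
  have hqd : Differentiable ℂ q := by fun_prop
  have hqv : ∀ y v, fderiv ℂ q y v =
      (y.1.1 - y.2.1) * (v.1.2 - v.2.2) + (y.1.2 - y.2.2) * (v.1.1 - v.2.1) := by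
    intro y v
    have h₁ : HasFDerivAt (fun y : (ℂ × ℂ) × (ℂ × ℂ) => y.1.1 - y.2.1) L₁ y := L₁.hasFDerivAt
    have h₂ : HasFDerivAt (fun y : (ℂ × ℂ) × (ℂ × ℂ) => y.1.2 - y.2.2) L₂ y := L₂.hasFDerivAt
    rw [hq, (h₁.fun_mul h₂).fderiv]
    simp [L₁, L₂]
  have hcomp : ∀ F : ℂ → ℂ, Differentiable ℂ F → ∀ y v,
      fderiv ℂ (fun y => F (q y)) y v = deriv F (q y) * fderiv ℂ q y v := by
    intro F hF y v
    have := ((hF (q y)).hasDerivAt.comp_hasFDerivAt y (hqd y).hasFDerivAt).fderiv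
    simp only [Function.comp_def] at this
    rw [this]
    simp
  have hRv : ∀ v, dirDeriv v (fun y => J (q y)) = fun y => deriv J (q y) *
      ((y.1.1 - y.2.1) * (v.1.2 - v.2.2) + (y.1.2 - y.2.2) * (v.1.1 - v.2.1)) := by
    intro v
    funext y
    rw [dirDeriv, hcomp J hJ, hqv]
  have hRη : dirDeriv dirEta (fun y => J (q y)) = fun y => deriv J (q y) * -(y.1.1 - y.2.1) := by
    rw [hRv]
    funext y
    simp [dirEta]
  refine ⟨fun y => J (q y), ⟨hJ.contDiff.comp (by fun_prop), ?_⟩, ?_, ?_, ?_, ?_⟩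
  · rw [hRη]
    funext y
    have hlin : HasFDerivAt (fun y : (ℂ × ℂ) × (ℂ × ℂ) => -(y.1.1 - y.2.1)) (-L₁) y := (-L₁).hasFDerivAt
    have hJq : HasFDerivAt (fun y => deriv J (q y)) (fderiv ℂ (fun y => deriv J (q y)) y) y :=
      ((hJ'.comp hqd) y).hasFDerivAt
    have h₁ := (hJq.fun_mul hlin).fderiv
    rw [dirDeriv, h₁, ← hJc]
    simp only [add_apply, smul_apply, hcomp _ hJ', hqv]
    simp [dirZeta, hq, L₁]
    ring
  · rw [hRv, hRv]
    funext y
    simp [dirZ, dirZeta]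
    ring
  · rw [hRv, hRv]
    funext y
    simp [dirW, dirEta]
    ring
  · intro z w η
    simp [hq, hJ0]
  · intro z w ζ
    simp [hq, hJ0]

namespace IsRiemannFunction

variable {c : ℂ} {R : (ℂ × ℂ) × (ℂ × ℂ) → ℂ} (hR : IsRiemannFunction c R)
include hR

theorem dirZ_dirW_eq (y) : dirDeriv dirZ (dirDeriv dirW R) y = c * R y := by
  rw [hR.dirW_eq, dirDeriv_neg]
  simp only
  rw [dirDeriv_comm hR.contDiff, hR.dirZ_eq, dirDeriv_neg, neg_neg, dirDeriv_comm hR.contDiff,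
    hR.eqn]

theorem dirEta_left (z w η : ℂ) : dirDeriv dirEta R ((z, w), (z, η)) = 0 :=
  dirDeriv_eq_zero_of_const (hR.contDiff.differentiable (by simp) _) (b := 1) fun t => by
    simpa [dirEta] using hR.eq_one_left z w (η + t)

theorem dirW_left (z w η : ℂ) : dirDeriv dirW R ((z, w), (z, η)) = 0 := by
  rw [hR.dirW_eq]
  simp [hR.dirEta_left]

theorem dirEta_dirW_left (z w η : ℂ) : dirDeriv dirEta (dirDeriv dirW R) ((z, w), (z, η)) = 0 :=
  dirDeriv_eq_zero_of_const ((hR.contDiff.dirDeriv _).differentiable (by simp) _) (b := 0)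
    fun t => by simpa [dirEta] using hR.dirW_left z w (η + t)

theorem dirZ_right (z w ζ : ℂ) : dirDeriv dirZ R ((z, w), (ζ, w)) = 0 := by
  rw [hR.dirZ_eq, neg_eq_zero]
  exact dirDeriv_eq_zero_of_const (hR.contDiff.differentiable (by simp) _) (b := 1) fun t => by
    simpa [dirZeta] using hR.eq_one_right z w (ζ + t)

/-- Here `∂_η ∂_z R = -∂_η ∂_ζ R = -c R`, and `R = 1`. This nonzero boundary value supplies the term
`c v` in `solvesMixedAt_snd`. -/
theorem dirEta_dirZ_right (z w ζ : ℂ) :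
    dirDeriv dirEta (dirDeriv dirZ R) ((z, w), (ζ, w)) = -c := by
  rw [hR.dirZ_eq, dirDeriv_neg, dirDeriv_comm hR.contDiff, hR.eqn]
  simp [hR.eq_one_right]

end IsRiemannFunction

/-! ### Wirtinger derivatives and the closed form attached to a kernel -/

/-- The real-linear map `h ↦ α h + β h̄` of the plane. -/
noncomputable def wirtingerCLM (α β : ℂ) : ℂ →L[ℝ] ℂ :=
  α • ContinuousLinearMap.id ℝ ℂ + β • (Complex.conjCLE : ℂ →L[ℝ] ℂ)

@[simp]
theorem wirtingerCLM_apply (α β h : ℂ) : wirtingerCLM α β h = α * h + β * starRingEnd ℂ h := by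
  simp [wirtingerCLM]

theorem eq_wirtingerCLM (L : ℂ →L[ℝ] ℂ) :
    L = wirtingerCLM ((L 1 - Complex.I * L Complex.I) / 2) ((L 1 + Complex.I * L Complex.I) / 2) := by
  ext h
  have h₁ : L h = h.re * L 1 + h.im * L Complex.I := by
    have : h = h.re • (1 : ℂ) + h.im • Complex.I := by simp [Complex.re_add_im]
    conv_lhs => rw [this]
    rw [map_add, map_smul, map_smul]
    simp
  rw [h₁, wirtingerCLM_apply]
  apply Complex.ext <;> simp <;> ring

/-- The Wirtinger derivative `∂v/∂z`. -/
noncomputable def wirtingerDz (v : ℂ → ℂ) (z : ℂ) : ℂ :=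
  (fderiv ℝ v z 1 - Complex.I * fderiv ℝ v z Complex.I) / 2

/-- The Wirtinger derivative `∂v/∂z̄`. -/
noncomputable def wirtingerDzbar (v : ℂ → ℂ) (z : ℂ) : ℂ :=
  (fderiv ℝ v z 1 + Complex.I * fderiv ℝ v z Complex.I) / 2

theorem DifferentiableAt.hasFDerivAt_wirtinger {v : ℂ → ℂ} {z : ℂ} (hv : DifferentiableAt ℝ v z) :
    HasFDerivAt v (wirtingerCLM (wirtingerDz v z) (wirtingerDzbar v z)) z :=
  hv.hasFDerivAt.congr_fderiv (eq_wirtingerCLM _)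

theorem Filter.EventuallyEq.wirtingerDz {v w : ℂ → ℂ} {z : ℂ} (h : v =ᶠ[𝓝 z] w) :
    wirtingerDz v z = wirtingerDz w z := by
  simp only [_root_.wirtingerDz, h.fderiv_eq]

/-- `v` solves `∂_z ∂_z̄ v = c v` on `V`. -/
def SolvesOn (c : ℂ) (V : Set ℂ) (v : ℂ → ℂ) : Prop :=
  ∀ z ∈ V, DifferentiableAt ℝ v z ∧
    ∃ p, HasFDerivAt (wirtingerDz v) (wirtingerCLM p (c * v z)) z

theorem SolvesOn.mono {c : ℂ} {V W : Set ℂ} {v : ℂ → ℂ} (hv : SolvesOn c V v) (h : W ⊆ V) :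
    SolvesOn c W v := fun z hz => hv z (h hz)

/-- `4 ∂_z ∂_z̄` is the Laplacian; symmetry of the second derivative cancels the mixed terms. -/
theorem solvesOn_of_helmholtz {k : ℂ} {V : Set ℂ} (hV : IsOpen V) {v : ℂ → ℂ}
    (hv : ContDiffOn ℝ 2 v V) (h : ∀ z ∈ V, Laplacian.laplacian v z + k ^ 2 * v z = 0) :
    SolvesOn (-(k ^ 2) / 4) V v := by
  intro z hz
  have hc : ContDiffAt ℝ 2 v z := hv.contDiffAt (hV.mem_nhds hz)
  have hd : HasFDerivAt (fderiv ℝ v) (fderiv ℝ (fderiv ℝ v) z) z :=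
    ((hc.fderiv_right (m := 1) (by norm_num)).differentiableAt (by simp)).hasFDerivAt
  have hs : IsSymmSndFDerivAt ℝ v z := hc.isSymmSndFDerivAt (by simp)
  have hw : HasFDerivAt (wirtingerDz v) _ z :=
    (((hd.clm_apply (hasFDerivAt_const (1 : ℂ) z)).sub
      ((hd.clm_apply (hasFDerivAt_const Complex.I z)).const_mul Complex.I)).mul_const
        (2⁻¹ : ℂ))
  have key := hw.congr_fderiv (eq_wirtingerCLM _)
  refine ⟨hc.differentiableAt (by simp), _, key.congr_fderiv (congrArg (wirtingerCLM _) ?_)⟩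
  have hl := h z hz
  rw [InnerProductSpace.laplacian_eq_iteratedFDeriv_complexPlane] at hl
  simp only [iteratedFDeriv_two_apply] at hl
  have hsym := hs 1 Complex.I
  simp at hl ⊢
  rw [hsym]
  have := Complex.I_sq
  linear_combination (1 / 4) * hl - (1 / 4) * (fderiv ℝ (fderiv ℝ v) z Complex.I) Complex.I * this

section Form

variable {c : ℂ} {K : (ℂ × ℂ) × (ℂ × ℂ) → ℂ} {v : ℂ → ℂ} {V : Set ℂ}

/-- The real point `ζ` of `ℂ²` in characteristic coordinates. -/
noncomputable def charPoint (ζ : ℂ) : ℂ × ℂ := (ζ, starRingEnd ℂ ζ)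

theorem continuous_charPoint : Continuous charPoint :=
  continuous_id.prodMk Complex.continuous_conj

theorem hasFDerivAt_kernel_charPoint (hK : ContDiff ℂ ∞ K) (x : ℂ × ℂ) (ζ : ℂ) :
    HasFDerivAt (fun ζ => K (x, charPoint ζ))
      (wirtingerCLM (dirDeriv dirZeta K (x, charPoint ζ)) (dirDeriv dirEta K (x, charPoint ζ))) ζ := by
  have h₁ : HasFDerivAt (fun ζ => (x, charPoint ζ))
      ((0 : ℂ →L[ℝ] ℂ × ℂ).prod ((ContinuousLinearMap.id ℝ ℂ).prod
        (Complex.conjCLE : ℂ →L[ℝ] ℂ))) ζ :=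
    (hasFDerivAt_const x ζ).prodMk ((hasFDerivAt_id ζ).prodMk Complex.conjCLE.hasFDerivAt)
  have h₂ := ((hK.differentiable (by simp)) (x, charPoint ζ)).hasFDerivAt.restrictScalars ℝ
  refine (h₂.comp ζ h₁).congr_fderiv ?_
  ext h
  have : ((0 : ℂ × ℂ), (h, starRingEnd ℂ h)) = h • dirZeta + starRingEnd ℂ h • dirEta := by
    simp [dirZeta, dirEta, Prod.mk_zero_zero]
  simp [dirDeriv, this, mul_comm]

/-- The 1-form `K ∂v dζ + v ∂_η K dζ̄`, which is closed if `∂_ζ ∂_η K = c K` and `∂∂̄ v = c v`. -/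
noncomputable def riemannForm (K : (ℂ × ℂ) × (ℂ × ℂ) → ℂ) (v : ℂ → ℂ) (x : ℂ × ℂ) (ζ : ℂ) :
    ℂ →L[ℝ] ℂ :=
  wirtingerCLM (K (x, charPoint ζ) * wirtingerDz v ζ) (dirDeriv dirEta K (x, charPoint ζ) * v ζ)

/-- Closedness: the `ζ̄`-derivative of `K ∂v` and the `ζ`-derivative of `v ∂_η K` both equal `∂_η K
∂v + c K v`. Only `v` and `∂v` need to be differentiable. -/
theorem exists_hasFDerivAt_riemannForm (hK : IsHelmholtzKernel c K) (hv : SolvesOn c V v)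
    (x : ℂ × ℂ) {ζ : ℂ} (hζ : ζ ∈ V) : ∃ D : ℂ →L[ℝ] ℂ →L[ℝ] ℂ,
      HasFDerivAt (riemannForm K v x) D ζ ∧ ∀ u w, D u w = D w u := by
  obtain ⟨hd, p, hp⟩ := hv ζ hζ
  have hA := (hasFDerivAt_kernel_charPoint hK.contDiff x ζ).mul hp
  have hB := (hasFDerivAt_kernel_charPoint (hK.contDiff.dirDeriv dirEta) x ζ).mul
    hd.hasFDerivAt_wirtinger
  refine ⟨_, (hA.smul_const (ContinuousLinearMap.id ℝ ℂ)).add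
    (hB.smul_const (Complex.conjCLE : ℂ →L[ℝ] ℂ)), fun u w => ?_⟩
  have e := congrFun hK.eqn (x, charPoint ζ)
  simp [e]
  ring

theorem continuousAt_riemannForm (hK : ContDiff ℂ ∞ K) (hv : SolvesOn c V v) (x : ℂ × ℂ) {ζ : ℂ}
    (hζ : ζ ∈ V) : ContinuousAt (fun y : (ℂ × ℂ) × ℂ => riemannForm K v y.1 y.2) (x, ζ) := by
  obtain ⟨hd, p, hp⟩ := hv ζ hζ
  have h₁ : Continuous fun y : (ℂ × ℂ) × ℂ => (y.1, charPoint y.2) :=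
    continuous_fst.prodMk (continuous_charPoint.comp continuous_snd)
  have h₂ : ContinuousAt (fun y : (ℂ × ℂ) × ℂ => wirtingerDz v y.2) (x, ζ) :=
    ContinuousAt.comp (f := Prod.snd) (x := (x, ζ)) hp.continuousAt continuousAt_snd
  have h₃ : ContinuousAt (fun y : (ℂ × ℂ) × ℂ => v y.2) (x, ζ) :=
    ContinuousAt.comp (f := Prod.snd) (x := (x, ζ)) hd.continuousAt continuousAt_snd
  have h₄ := (hK.continuous.comp h₁).continuousAt (x := (x, ζ))
  have h₅ := ((hK.dirDeriv dirEta).continuous.comp h₁).continuousAt (x := (x, ζ))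
  exact ((h₄.mul h₂).smul continuousAt_const).add ((h₅.mul h₃).smul continuousAt_const)

/-- The pairing of a kernel and of its `η`-derivative with densities on a curve. -/
noncomputable def kernelIntegral (K : (ℂ × ℂ) × (ℂ × ℂ) → ℂ) (y : ℝ → ℂ × ℂ) (P Q : ℝ → ℂ)
    (s t : ℝ) (x : ℂ × ℂ) : ℂ :=
  ∫ τ in s..t, K (x, y τ) * P τ + dirDeriv dirEta K (x, y τ) * Q τ

/-- The variable `x` enters through the entire kernel alone, so the integral is holomorphic in `x`
although the density is merely continuous. -/
theorem hasFDerivAt_integral_kernel (hK : ContDiff ℂ ∞ K) {y : ℝ → ℂ × ℂ} {P : ℝ → ℂ} {s t : ℝ}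
    (hy : ContinuousOn y (uIcc s t)) (hP : ContinuousOn P (uIcc s t)) (x : ℂ × ℂ) :
    ∃ Ψ : ℂ × ℂ →L[ℂ] ℂ, HasFDerivAt (fun x => ∫ τ in s..t, K (x, y τ) * P τ) Ψ x ∧
      ∀ h, Ψ h = ∫ τ in s..t, dirDeriv (h, 0) K (x, y τ) * P τ := by
  have hdK : Continuous (fderiv ℂ K) := (hK.fderiv_right (m := ∞) (by simp)).continuous
  set F' : ℂ × ℂ → ℝ → ℂ × ℂ →L[ℂ] ℂ := fun x τ =>
    P τ • (fderiv ℂ K (x, y τ)).comp (ContinuousLinearMap.inl ℂ (ℂ × ℂ) (ℂ × ℂ)) with hF'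
  have hpair : ContinuousOn (fun q : (ℂ × ℂ) × ℝ => (q.1, y q.2)) (univ ×ˢ uIcc s t) :=
    continuousOn_fst.prodMk (hy.comp continuousOn_snd fun q hq => hq.2)
  have hF'c : ContinuousOn (fun q : (ℂ × ℂ) × ℝ => F' q.1 q.2) (univ ×ˢ uIcc s t) := by
    refine (hP.comp continuousOn_snd fun q hq => hq.2).smul ?_
    exact (hdK.comp_continuousOn hpair).clm_comp continuousOn_const
  have hxc : ∀ x : ℂ × ℂ, ContinuousOn (fun τ : ℝ => (x, τ)) (uIcc s t) := fun x =>
    continuousOn_const.prodMk continuousOn_id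
  have hFc : ∀ x, ContinuousOn (fun τ => K (x, y τ) * P τ) (uIcc s t) := fun x =>
    (hK.continuous.comp_continuousOn (hpair.comp (hxc x) fun τ hτ => ⟨trivial, hτ⟩)).mul hP
  have hF'x : ∀ x, ContinuousOn (F' x) (uIcc s t) := fun x =>
    hF'c.comp (hxc x) fun τ hτ => ⟨trivial, hτ⟩
  obtain ⟨B, hB⟩ := ((isCompact_closedBall x 1).prod (isCompact_uIcc (a := s) (b := t))
    ).exists_bound_of_continuousOn (hF'c.mono (prod_mono_left (subset_univ _)))
  refine ⟨∫ τ in s..t, F' x τ, ?_, fun h => ?_⟩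
  · refine intervalIntegral.hasFDerivAt_integral_of_dominated_of_fderiv_le (bound := fun _ => B)
      (Metric.closedBall_mem_nhds x one_pos) ?_ (hFc x).intervalIntegrable ?_ ?_
      intervalIntegrable_const ?_
    · refine Eventually.of_forall fun x => ?_
      exact ((hFc x).mono uIoc_subset_uIcc).aestronglyMeasurable measurableSet_uIoc
    · exact ((hF'x x).mono uIoc_subset_uIcc).aestronglyMeasurable measurableSet_uIoc
    · exact Eventually.of_forall fun τ hτ x' hx' => hB (x', τ) ⟨hx', uIoc_subset_uIcc hτ⟩
    · refine Eventually.of_forall fun τ _ x' _ => ?_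
      have h₁ : HasFDerivAt (fun x : ℂ × ℂ => (x, y τ))
          (ContinuousLinearMap.inl ℂ (ℂ × ℂ) (ℂ × ℂ)) x' := hasFDerivAt_prodMk_left x' (y τ)
      have h₂ := ((hK.differentiable (by simp)) (x', y τ)).hasFDerivAt.comp x' h₁
      exact h₂.mul_const (P τ)
  · rw [ContinuousLinearMap.intervalIntegral_apply (hF'x x).intervalIntegrable]
    refine intervalIntegral.integral_congr fun τ _ => ?_
    simp [hF', dirDeriv, mul_comm]

theorem continuousOn_kernel_mul (hK : ContDiff ℂ ∞ K) {y : ℝ → ℂ × ℂ} {P : ℝ → ℂ} {s : Set ℝ}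
    (hy : ContinuousOn y s) (hP : ContinuousOn P s) (x : ℂ × ℂ) :
    ContinuousOn (fun τ => K (x, y τ) * P τ) s :=
  (hK.continuous.comp_continuousOn (continuousOn_const.prodMk hy)).mul hP

theorem hasFDerivAt_kernelIntegral (hK : ContDiff ℂ ∞ K) {y : ℝ → ℂ × ℂ} {P Q : ℝ → ℂ} {s t : ℝ}
    (hy : ContinuousOn y (uIcc s t)) (hP : ContinuousOn P (uIcc s t))
    (hQ : ContinuousOn Q (uIcc s t)) (x : ℂ × ℂ) :
    ∃ Ψ : ℂ × ℂ →L[ℂ] ℂ, HasFDerivAt (kernelIntegral K y P Q s t) Ψ x ∧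
      ∀ h, Ψ h = kernelIntegral (dirDeriv (h, 0) K) y P Q s t x := by
  obtain ⟨Ψ₁, h₁, e₁⟩ := hasFDerivAt_integral_kernel hK hy hP x
  obtain ⟨Ψ₂, h₂, e₂⟩ := hasFDerivAt_integral_kernel (hK.dirDeriv dirEta) hy hQ x
  have hint : ∀ {K' : (ℂ × ℂ) × (ℂ × ℂ) → ℂ}, ContDiff ℂ ∞ K' → ∀ x,
      kernelIntegral K' y P Q s t x = (∫ τ in s..t, K' (x, y τ) * P τ) +
        ∫ τ in s..t, dirDeriv dirEta K' (x, y τ) * Q τ := fun hK' x =>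
    intervalIntegral.integral_add (continuousOn_kernel_mul hK' hy hP x).intervalIntegrable
      (continuousOn_kernel_mul (hK'.dirDeriv _) hy hQ x).intervalIntegrable
  refine ⟨Ψ₁ + Ψ₂, ?_, fun h => ?_⟩
  · rw [show kernelIntegral K y P Q s t = _ from funext (hint hK)]
    exact h₁.add h₂
  · rw [hint (hK.dirDeriv _), add_apply, e₁, e₂, dirDeriv_comm hK]

/-- The integral of `riemannForm` along the segment from `b` to `ζ`. -/
noncomputable def segmentIntegral (K : (ℂ × ℂ) × (ℂ × ℂ) → ℂ) (v : ℂ → ℂ) (b : ℂ) (x : ℂ × ℂ)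
    (ζ : ℂ) : ℂ :=
  kernelIntegral K (fun t => charPoint (AffineMap.lineMap b ζ t))
    (fun t => wirtingerDz v (AffineMap.lineMap b ζ t) * (ζ - b))
    (fun t => v (AffineMap.lineMap b ζ t) * starRingEnd ℂ (ζ - b)) 0 1 x

theorem segmentIntegral_eq (b : ℂ) (x : ℂ × ℂ) (ζ : ℂ) :
    segmentIntegral K v b x ζ =
      ∫ t in (0 : ℝ)..1, riemannForm K v x (AffineMap.lineMap b ζ t) (ζ - b) := by
  refine intervalIntegral.integral_congr fun t _ => ?_
  simp only [riemannForm, wirtingerCLM_apply]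
  ring

@[simp]
theorem segmentIntegral_self (b : ℂ) (x : ℂ × ℂ) : segmentIntegral K v b x b = 0 := by
  simp [segmentIntegral_eq]

/-- Poincaré's lemma on a convex set: a closed form is the differential of its integral along
segments from `b`. -/
theorem hasFDerivAt_segmentIntegral (hK : IsHelmholtzKernel c K) (hV : IsOpen V) (hVc : Convex ℝ V)
    (hv : SolvesOn c V v) {b : ℂ} (hb : b ∈ V) (x : ℂ × ℂ) {ζ : ℂ} (hζ : ζ ∈ V) :
    HasFDerivAt (segmentIntegral K v b x) (riemannForm K v x ζ) ζ := by
  choose D hD hDs using fun ζ : V => exists_hasFDerivAt_riemannForm hK hv x ζ.2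
  classical
  set D' : ℂ → ℂ →L[ℝ] ℂ →L[ℝ] ℂ := fun ζ => if h : ζ ∈ V then D ⟨ζ, h⟩ else 0 with hD'
  have hform : ∀ z ∈ V, HasFDerivWithinAt (riemannForm K v x) (D' z) V z := fun z hz => by
    simpa [hD', hz] using (hD ⟨z, hz⟩).hasFDerivWithinAt
  have h := hVc.hasFDerivWithinAt_curveIntegral_segment_of_hasFDerivWithinAt_symmetric hform
    (fun z hz u _ w _ => by simpa [hD', hz] using hDs ⟨z, hz⟩ u w) hb hζ
  have e : segmentIntegral K v b x = fun ζ => curveIntegral (riemannForm K v x) (.segment b ζ) := by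
    funext ζ
    rw [segmentIntegral_eq, curveIntegral_segment]
  rw [e]
  exact h.hasFDerivAt (hV.mem_nhds hζ)

theorem hasFDerivAt_segmentIntegral_left (hK : ContDiff ℂ ∞ K) (hVc : Convex ℝ V)
    (hv : SolvesOn c V v) {b : ℂ} (hb : b ∈ V) (x : ℂ × ℂ) {ζ : ℂ} (hζ : ζ ∈ V) :
    ∃ Ψ : ℂ × ℂ →L[ℂ] ℂ, HasFDerivAt (fun x => segmentIntegral K v b x ζ) Ψ x ∧
      ∀ h, Ψ h = segmentIntegral (dirDeriv (h, 0) K) v b x ζ := by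
  have hl : Continuous fun t : ℝ => AffineMap.lineMap b ζ t := AffineMap.lineMap_continuous
  have hmem : ∀ t ∈ uIcc (0 : ℝ) 1, AffineMap.lineMap b ζ t ∈ V := fun t ht => by
    rw [uIcc_of_le zero_le_one] at ht
    exact hVc.lineMap_mem hb hζ ht
  refine hasFDerivAt_kernelIntegral hK (continuous_charPoint.comp hl).continuousOn
    (ContinuousOn.mul ?_ continuousOn_const) (ContinuousOn.mul ?_ continuousOn_const) x
  · intro t ht
    obtain ⟨-, p, hp⟩ := hv _ (hmem t ht)
    exact (ContinuousAt.comp (f := fun t : ℝ => AffineMap.lineMap b ζ t) hp.continuousAt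
      hl.continuousAt).continuousWithinAt
  · intro t ht
    exact (ContinuousAt.comp (f := fun t : ℝ => AffineMap.lineMap b ζ t)
      (hv _ (hmem t ht)).1.continuousAt hl.continuousAt).continuousWithinAt

theorem riemannForm_congr {w : ℂ → ℂ} {ζ : ℂ} (h : v =ᶠ[𝓝 ζ] w) (x : ℂ × ℂ) :
    riemannForm K v x ζ = riemannForm K w x ζ := by
  rw [riemannForm, riemannForm, h.wirtingerDz, h.eq_of_nhds]

end Form

/-! ### Integrals of the form along a path of germs -/

/-- The derivative of `y ↦ F y (L y)` from the partial derivatives of `F`, of which only the second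
has to be continuous. -/
theorem hasFDerivAt_diag {E : Type*} [NormedAddCommGroup E] [NormedSpace ℝ E] {F : E → ℂ → ℂ}
    {G : E → ℂ → ℂ →L[ℝ] ℂ} {L : E →L[ℝ] ℂ} {x : E} {Ψ : E →L[ℝ] ℂ}
    (h₁ : HasFDerivAt (fun y => F y (L x)) Ψ x)
    (h₂ : ∀ᶠ p : E × ℂ in 𝓝 (x, L x), HasFDerivAt (F p.1) (G p.1 p.2) p.2)
    (h₃ : ContinuousAt (fun p : E × ℂ => G p.1 p.2) (x, L x)) :
    HasFDerivAt (fun y => F y (L y)) (Ψ + (G x (L x)).comp L) x := by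
  have key : (fun y => F y (L y) - F y (L x) - G x (L x) (L y - L x)) =o[𝓝 x]
      fun y => L y - L x := by
    rw [Asymptotics.isLittleO_iff]
    intro ε hε
    obtain ⟨δ, hδ, hb⟩ := Metric.eventually_nhds_iff_ball.1
      (h₂.and (h₃.eventually (Metric.closedBall_mem_nhds _ hε)))
    filter_upwards [Metric.ball_mem_nhds x hδ,
      L.continuous.continuousAt.preimage_mem_nhds (Metric.ball_mem_nhds (L x) hδ)] with y hy hLy
    have hmem : ∀ ζ ∈ Metric.ball (L x) δ, (y, ζ) ∈ Metric.ball (x, L x) δ := fun ζ hζ => by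
      rw [← ball_prod_same]
      exact ⟨hy, hζ⟩
    -- Mean value inequality for `F y` between `L x` and `L y`, where its derivative stays within
    -- `ε` of `G x (L x)`.
    exact (convex_ball (L x) δ).norm_image_sub_le_of_norm_hasFDerivWithin_le'
      (fun ζ hζ => (hb _ (hmem ζ hζ)).1.hasFDerivWithinAt)
      (fun ζ hζ => by simpa [dist_eq_norm] using (hb _ (hmem ζ hζ)).2)
      (Metric.mem_ball_self hδ) hLy
  refine .of_isLittleO ?_
  refine ((h₁.isLittleO).add (key.trans_isBigO (by simpa only [map_sub] using L.isBigO_sub (𝓝 x) x))).congr_left fun y => ?_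
  simp only [add_apply, ContinuousLinearMap.comp_apply, map_sub]
  ring

/-- Solutions `v τ` of `∂_z ∂_z̄ v = c v` near the points `a τ` of a path, which continue each
other. -/
structure IsSolutionAlong (c : ℂ) (a : ℝ → ℂ) (v : ℝ → ℂ → ℂ) : Prop where
  path : ContDiffOn ℝ 1 a (Icc 0 1)
  solves : ∀ τ ∈ Icc (0 : ℝ) 1, ∃ r > 0, SolvesOn c (Metric.ball (a τ) r) (v τ)
  coherent : ∀ τ ∈ Icc (0 : ℝ) 1, ∀ᶠ τ' in 𝓝[Icc 0 1] τ, v τ' =ᶠ[𝓝 (a τ')] v τ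

/-- The density along the path of the `dζ`-part of `riemannForm`. -/
noncomputable def densityDz (a : ℝ → ℂ) (v : ℝ → ℂ → ℂ) (t : ℝ) : ℂ :=
  wirtingerDz (v t) (a t) * derivWithin a (Icc 0 1) t

/-- The density along the path of the `dζ̄`-part of `riemannForm`. -/
noncomputable def densityDzbar (a : ℝ → ℂ) (v : ℝ → ℂ → ℂ) (t : ℝ) : ℂ :=
  v t (a t) * starRingEnd ℂ (derivWithin a (Icc 0 1) t)

/-- The integral of `riemannForm` along the path `a` up to the time `τ`, and on from `a τ` to the
nearby point `ζ`. -/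
noncomputable def pathIntegral (K : (ℂ × ℂ) × (ℂ × ℂ) → ℂ) (a : ℝ → ℂ) (v : ℝ → ℂ → ℂ) (τ : ℝ)
    (x : ℂ × ℂ) (ζ : ℂ) : ℂ :=
  kernelIntegral K (fun t => charPoint (a t)) (densityDz a v) (densityDzbar a v) 0 τ x +
    segmentIntegral K (v τ) (a τ) x ζ

theorem kernelIntegral_const_mul {K : (ℂ × ℂ) × (ℂ × ℂ) → ℂ} (hK : ContDiff ℂ ∞ K) (c : ℂ)
    (y : ℝ → ℂ × ℂ) (P Q : ℝ → ℂ) (s t : ℝ) (x : ℂ × ℂ) :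
    kernelIntegral (fun y => c * K y) y P Q s t x = c * kernelIntegral K y P Q s t x := by
  simp only [kernelIntegral, dirDeriv_const_mul hK]
  rw [← intervalIntegral.integral_const_mul]
  congr 1
  funext τ
  ring

theorem pathIntegral_const_mul {K : (ℂ × ℂ) × (ℂ × ℂ) → ℂ} (hK : ContDiff ℂ ∞ K) (c : ℂ)
    (a : ℝ → ℂ) (v : ℝ → ℂ → ℂ) (τ : ℝ) (x : ℂ × ℂ) (ζ : ℂ) :
    pathIntegral (fun y => c * K y) a v τ x ζ = c * pathIntegral K a v τ x ζ := by
  simp only [pathIntegral, segmentIntegral, kernelIntegral_const_mul hK]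
  ring

theorem hasFDerivAt_pathIntegral {c : ℂ} {a : ℝ → ℂ} {v : ℝ → ℂ → ℂ}
    {K : (ℂ × ℂ) × (ℂ × ℂ) → ℂ} {τ r : ℝ} (hK : IsHelmholtzKernel c K)
    (hs : SolvesOn c (Metric.ball (a τ) r) (v τ)) (x : ℂ × ℂ) {ζ : ℂ}
    (hζ : ζ ∈ Metric.ball (a τ) r) :
    HasFDerivAt (pathIntegral K a v τ x) (riemannForm K (v τ) x ζ) ζ :=
  (hasFDerivAt_segmentIntegral hK Metric.isOpen_ball (convex_ball _ _) hs
    (Metric.mem_ball_self (Metric.pos_of_mem_ball hζ)) x hζ).const_add _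

namespace IsSolutionAlong

variable {c : ℂ} {a : ℝ → ℂ} {v : ℝ → ℂ → ℂ} (h : IsSolutionAlong c a v)
  {K : (ℂ × ℂ) × (ℂ × ℂ) → ℂ} {τ : ℝ} {r : ℝ}
include h

theorem continuousOn_derivWithin : ContinuousOn (derivWithin a (Icc 0 1)) (Icc 0 1) :=
  h.path.continuousOn_derivWithin (uniqueDiffOn_Icc zero_lt_one) le_rfl

theorem continuousOn_densityDz : ContinuousOn (densityDz a v) (Icc 0 1) := by
  refine ContinuousOn.mul (fun τ hτ => ?_) h.continuousOn_derivWithin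
  obtain ⟨r, hr, hs⟩ := h.solves τ hτ
  obtain ⟨-, p, hp⟩ := hs (a τ) (Metric.mem_ball_self hr)
  refine (hp.continuousAt.comp_continuousWithinAt
    (h.path.continuousOn τ hτ)).congr_of_eventuallyEq ?_ rfl
  filter_upwards [h.coherent τ hτ] with t ht using ht.wirtingerDz

theorem continuousOn_densityDzbar : ContinuousOn (densityDzbar a v) (Icc 0 1) := by
  refine ContinuousOn.mul (fun τ hτ => ?_)
    (Complex.continuous_conj.comp_continuousOn h.continuousOn_derivWithin)
  obtain ⟨r, hr, hs⟩ := h.solves τ hτ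
  refine ((hs (a τ) (Metric.mem_ball_self hr)).1.continuousAt.comp_continuousWithinAt
    (h.path.continuousOn τ hτ)).congr_of_eventuallyEq ?_ rfl
  filter_upwards [h.coherent τ hτ] with t ht using ht.eq_of_nhds

theorem continuousOn_charPoint : ContinuousOn (fun t => charPoint (a t)) (Icc 0 1) :=
  continuous_charPoint.comp_continuousOn h.path.continuousOn

/-- The derivative has two sources. The kernel gives the complex-linear part `Ψ`; the moving
endpoint `L x` gives the value of the form there, which in general is only real-linear. The map `L`
will be `z` or `w̄`. -/
theorem hasFDerivAt_pathIntegral_diag (hK : IsHelmholtzKernel c K) (hτ : τ ∈ Icc (0 : ℝ) 1)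
    (hs : SolvesOn c (Metric.ball (a τ) r) (v τ)) (L : ℂ × ℂ →L[ℝ] ℂ) {x : ℂ × ℂ}
    (hx : L x ∈ Metric.ball (a τ) r) :
    ∃ Ψ : ℂ × ℂ →L[ℂ] ℂ, HasFDerivAt (fun y => pathIntegral K a v τ y (L y))
      (Ψ.restrictScalars ℝ + (riemannForm K (v τ) x (L x)).comp L) x ∧
      ∀ e, Ψ e = pathIntegral (dirDeriv (e, 0) K) a v τ x (L x) := by
  have hsub : uIcc 0 τ ⊆ Icc (0 : ℝ) 1 := by
    rw [uIcc_of_le hτ.1]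
    exact Icc_subset_Icc_right hτ.2
  obtain ⟨Ψ₁, h₁, e₁⟩ := hasFDerivAt_kernelIntegral hK.contDiff (h.continuousOn_charPoint.mono hsub)
    (h.continuousOn_densityDz.mono hsub) (h.continuousOn_densityDzbar.mono hsub) x
  obtain ⟨Ψ₂, h₂, e₂⟩ := hasFDerivAt_segmentIntegral_left hK.contDiff (convex_ball _ _) hs
    (Metric.mem_ball_self (Metric.pos_of_mem_ball hx)) x hx
  refine ⟨Ψ₁ + Ψ₂, hasFDerivAt_diag (h₁.add h₂ |>.restrictScalars ℝ) ?_
    (continuousAt_riemannForm hK.contDiff hs x hx), fun e => ?_⟩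
  · filter_upwards [(continuous_snd.continuousAt (x := (x, L x))).preimage_mem_nhds
      (Metric.isOpen_ball.mem_nhds hx)] with p hp
    exact hasFDerivAt_pathIntegral hK hs p.1 hp
  · rw [add_apply, e₁, e₂, pathIntegral]

/-- At `ζ = a τ'` the equality is the fundamental theorem of calculus: the segment primitive based
at `a τ`, followed along the path, has the path integrand as its derivative. Nearby, both sides are
primitives of the same form, so they continue to agree. -/
theorem pathIntegral_coherent (hK : IsHelmholtzKernel c K) (hτ : τ ∈ Icc (0 : ℝ) 1) :
    ∀ᶠ τ' in 𝓝[Icc 0 1] τ, ∀ᶠ ζ in 𝓝 (a τ'), ∀ x,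
      pathIntegral K a v τ' x ζ = pathIntegral K a v τ x ζ := by
  obtain ⟨r, hr, hs⟩ := h.solves τ hτ
  obtain ⟨ε, hε, hball⟩ := Metric.mem_nhdsWithin_iff.1 (Filter.inter_mem (h.coherent τ hτ)
    ((h.path.continuousOn τ hτ).preimage_mem_nhdsWithin (Metric.ball_mem_nhds (a τ) hr)))
  filter_upwards [self_mem_nhdsWithin, mem_nhdsWithin_of_mem_nhds (Metric.ball_mem_nhds τ hε)]
    with τ' hτ' hd
  have hsub : uIcc τ τ' ⊆ Metric.ball τ ε ∩ Icc 0 1 :=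
    OrdConnected.uIcc_subset
      (((convex_ball τ ε).inter (convex_Icc (0 : ℝ) 1)).ordConnected)
      ⟨Metric.mem_ball_self hε, hτ⟩ ⟨hd, hτ'⟩
  have hmem : ∀ t ∈ uIcc τ τ', v t =ᶠ[𝓝 (a t)] v τ ∧ a t ∈ Metric.ball (a τ) r :=
    fun t ht => hball (hsub ht)
  have hint : ∀ {s t : ℝ}, s ∈ Icc (0 : ℝ) 1 → t ∈ Icc (0 : ℝ) 1 → ∀ x,
      IntervalIntegrable (fun τ => K (x, charPoint (a τ)) * densityDz a v τ +
        dirDeriv dirEta K (x, charPoint (a τ)) * densityDzbar a v τ) MeasureTheory.volume s t :=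
    fun hs ht x => (ContinuousOn.mono (((continuousOn_kernel_mul hK.contDiff
      h.continuousOn_charPoint h.continuousOn_densityDz x).add (continuousOn_kernel_mul
      (hK.contDiff.dirDeriv _) h.continuousOn_charPoint h.continuousOn_densityDzbar x)))
      (OrdConnected.uIcc_subset ordConnected_Icc hs ht)).intervalIntegrable
  have hend : ∀ x, pathIntegral K a v τ' x (a τ') = pathIntegral K a v τ x (a τ') := fun x => by
    have hF : ∀ t ∈ uIcc τ τ', HasDerivWithinAt (fun t => segmentIntegral K (v τ) (a τ) x (a t))
        (K (x, charPoint (a t)) * densityDz a v t +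
        dirDeriv dirEta K (x, charPoint (a t)) * densityDzbar a v t) (Icc 0 1) t := fun t ht => by
      have h₁ := hasFDerivAt_segmentIntegral hK Metric.isOpen_ball (convex_ball _ _) hs
        (Metric.mem_ball_self hr) x (hmem t ht).2
      have h₂ := (h.path.differentiableOn one_ne_zero t (hsub ht).2).hasDerivWithinAt
      have h₃ := h₁.comp_hasDerivWithinAt t h₂
      rw [← riemannForm_congr (hmem t ht).1, riemannForm, wirtingerCLM_apply] at h₃
      refine h₃.congr_deriv ?_
      simp only [densityDz, densityDzbar]
      ring
    have hftc := intervalIntegral.integral_eq_sub_of_hasDeriv_right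
      (fun t ht => ((hF t ht).continuousWithinAt).mono fun s hs => (hsub hs).2)
      (fun t ht => ((hF t (Ioo_subset_Icc_self ht)).hasDerivAt (mem_of_superset
        (isOpen_Ioo.mem_nhds ht) fun s hs => (hsub (Ioo_subset_Icc_self hs)).2)).hasDerivWithinAt)
      (hint hτ hτ' x)
    rw [pathIntegral, pathIntegral, segmentIntegral_self, add_zero, kernelIntegral,
      ← intervalIntegral.integral_add_adjacent_intervals (hint (by simp) hτ x) (hint hτ hτ' x),
      hftc, segmentIntegral_self, sub_zero, kernelIntegral]
  obtain ⟨r', hr', hs'⟩ := h.solves τ' hτ'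
  have hm := hmem τ' right_mem_uIcc
  obtain ⟨ρ, hρ, hsubρ⟩ := Metric.mem_nhds_iff.1 (Filter.inter_mem
    (Metric.ball_mem_nhds (a τ') hr') (Filter.inter_mem (eventually_eventually_nhds.2 hm.1)
      (Metric.isOpen_ball.mem_nhds hm.2)))
  filter_upwards [Metric.ball_mem_nhds (a τ') hρ] with ζ hζ x
  have d₁ := fun ζ (hζ : ζ ∈ Metric.ball (a τ') ρ) =>
    hasFDerivAt_pathIntegral hK hs' x (hsubρ hζ).1
  have d₂ := fun ζ (hζ : ζ ∈ Metric.ball (a τ') ρ) =>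
    hasFDerivAt_pathIntegral hK hs x (hsubρ hζ).2.2
  refine IsOpen.eqOn_of_fderiv_eq Metric.isOpen_ball (convex_ball _ _).isPreconnected
    (fun ζ hζ => (d₁ ζ hζ).differentiableAt.differentiableWithinAt)
    (fun ζ hζ => (d₂ ζ hζ).differentiableAt.differentiableWithinAt)
    (fun ζ hζ => ?_) (Metric.mem_ball_self hρ) (hend x) hζ
  rw [(d₁ ζ hζ).fderiv, (d₂ ζ hζ).fderiv, riemannForm_congr (hsubρ hζ).2.1]

end IsSolutionAlong

/-! ### Holomorphic solutions of the mixed equation -/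

/-- `U` is holomorphic at `x` and solves `∂_z ∂_w U = c U` near `x`. -/
structure SolvesMixedAt (c : ℂ) (U : ℂ × ℂ → ℂ) (x : ℂ × ℂ) : Prop where
  analyticAt : AnalyticAt ℂ U x
  eqn : ∀ᶠ y in 𝓝 x, fderiv ℂ (fderiv ℂ U) y (1, 0) (0, 1) = c * U y

theorem AnalyticAt.fderiv_fderiv_comm {U : ℂ × ℂ → ℂ} {x : ℂ × ℂ} (hU : AnalyticAt ℂ U x)
    (v w : ℂ × ℂ) : fderiv ℂ (fderiv ℂ U) x v w = fderiv ℂ (fderiv ℂ U) x w v :=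
  (hU.contDiffAt (n := ω)).isSymmSndFDerivAt (by simp) v w

theorem SolvesMixedAt.add {c : ℂ} {U V : ℂ × ℂ → ℂ} {x : ℂ × ℂ} (hU : SolvesMixedAt c U x)
    (hV : SolvesMixedAt c V x) : SolvesMixedAt c (fun y => U y + V y) x := by
  refine ⟨hU.analyticAt.add hV.analyticAt, ?_⟩
  filter_upwards [hU.eqn, hV.eqn, hU.analyticAt.eventually_analyticAt,
    hV.analyticAt.eventually_analyticAt] with y h₁ h₂ h₃ h₄
  have e : fderiv ℂ (fun y => U y + V y) =ᶠ[𝓝 y] fun y => fderiv ℂ U y + fderiv ℂ V y := by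
    filter_upwards [h₃.eventually_analyticAt, h₄.eventually_analyticAt] with z h₅ h₆
    exact fderiv_fun_add h₅.differentiableAt h₆.differentiableAt
  rw [e.fderiv_eq, fderiv_fun_add h₃.fderiv.differentiableAt h₄.fderiv.differentiableAt]
  simp only [add_apply, h₁, h₂]
  ring

/-- A criterion which only asks for real differentiability of one first derivative. -/
theorem analyticAt_and_fderiv_fderiv {c : ℂ} {O : Set (ℂ × ℂ)} (hO : IsOpen O)
    {U g : ℂ × ℂ → ℂ} {e e' : ℂ × ℂ} (hU : ∀ x ∈ O, ∃ Ψ : ℂ × ℂ →L[ℂ] ℂ,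
      HasFDerivAt U Ψ x ∧ Ψ e = g x)
    (hg : ∀ x ∈ O, ∃ G : ℂ × ℂ →L[ℝ] ℂ, HasFDerivAt g G x ∧ G e' = c * U x) {x : ℂ × ℂ}
    (hx : x ∈ O) : AnalyticAt ℂ U x ∧ fderiv ℂ (fderiv ℂ U) x e' e = c * U x := by
  have ha : AnalyticAt ℂ U x := Complex.analyticAt_prod_of_eventually_differentiableAt <| by
    filter_upwards [hO.mem_nhds hx] with y hy
    obtain ⟨Ψ, hΨ, -⟩ := hU y hy
    exact hΨ.differentiableAt
  refine ⟨ha, ?_⟩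
  have hd : DifferentiableAt ℂ (fderiv ℂ U) x := ha.fderiv.differentiableAt
  rw [← fderiv_fderiv_apply hd]
  have hg' : dirDeriv e U =ᶠ[𝓝 x] g := by
    filter_upwards [hO.mem_nhds hx] with y hy
    obtain ⟨Ψ, hΨ, he⟩ := hU y hy
    rw [dirDeriv, hΨ.fderiv, he]
  obtain ⟨G, hG, hGe⟩ := hg x hx
  have h₁ : HasFDerivAt (dirDeriv e U) (fderiv ℂ (dirDeriv e U) x) x :=
    (hd.clm_apply (differentiableAt_const e)).hasFDerivAt
  -- Once `U` is known to be analytic, `g` is one of its holomorphic derivatives, so the real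
  -- derivative given for `g` must be the complex one.
  have h₂ := (h₁.restrictScalars ℝ).unique (hG.congr_of_eventuallyEq hg')
  rw [← hGe, ← h₂]
  rfl

namespace IsSolutionAlong

variable {c : ℂ} {R : (ℂ × ℂ) × (ℂ × ℂ) → ℂ}

/-- The solution of the mixed equation whose Goursat data are those of `v` on the first family of
characteristics. -/
theorem solvesMixedAt_fst {a : ℝ → ℂ} {v : ℝ → ℂ → ℂ} (h : IsSolutionAlong c a v)
    (hR : IsRiemannFunction c R) {τ : ℝ} (hτ : τ ∈ Icc (0 : ℝ) 1) (w : ℂ) :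
    SolvesMixedAt c (fun x => pathIntegral R a v τ x x.1) (a τ, w) := by
  obtain ⟨r, hr, hs⟩ := h.solves τ hτ
  set O : Set (ℂ × ℂ) := Prod.fst ⁻¹' Metric.ball (a τ) r
  have hO : IsOpen O := Metric.isOpen_ball.preimage continuous_fst
  have hmem : (a τ, w) ∈ O := Metric.mem_ball_self hr
  set L : ℂ × ℂ →L[ℝ] ℂ := (ContinuousLinearMap.fst ℂ ℂ ℂ).restrictScalars ℝ
  have key : ∀ x ∈ O, AnalyticAt ℂ (fun x => pathIntegral R a v τ x x.1) x ∧
      fderiv ℂ (fderiv ℂ fun x => pathIntegral R a v τ x x.1) x (1, 0) (0, 1) =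
        c * pathIntegral R a v τ x x.1 := fun x hx => by
    refine analyticAt_and_fderiv_fderiv hO
      (g := fun x => pathIntegral (dirDeriv dirW R) a v τ x x.1) (fun x hx => ?_)
      (fun x hx => ?_) hx
    · obtain ⟨Ψ, hΨ, he⟩ := h.hasFDerivAt_pathIntegral_diag hR.toIsHelmholtzKernel hτ hs L hx
      -- On `ζ = z` one has `R = 1` and `∂_η R = 0`, so the endpoint contributes just `∂v dz`, which
      -- is complex-linear and has no `dw` part.
      refine ⟨Ψ + wirtingerDz (v τ) x.1 • ContinuousLinearMap.fst ℂ ℂ ℂ,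
        hasFDerivAt_of_restrictScalars ℝ hΨ ?_, ?_⟩
      · refine ContinuousLinearMap.ext fun y => ?_
        have e₁ : R (x, charPoint (L x)) = 1 := hR.eq_one_left x.1 x.2 _
        have e₂ : dirDeriv dirEta R (x, charPoint (L x)) = 0 := hR.dirEta_left x.1 x.2 _
        simp [riemannForm, e₁, e₂]
        simp [L]
      · have e := he (0, 1)
        simp at e ⊢
        exact e
    -- For the kernel `∂_w R` the endpoint contributes nothing on `ζ = z`, and `∂_z ∂_w R = c R`
    -- turns the rest into `c U`.
    · obtain ⟨Ψ, hΨ, he⟩ := h.hasFDerivAt_pathIntegral_diag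
        (hR.toIsHelmholtzKernel.dirDeriv dirW) hτ hs L hx
      refine ⟨_, hΨ, ?_⟩
      have e₁ : dirDeriv dirW R (x, charPoint (L x)) = 0 := hR.dirW_left x.1 x.2 _
      have e₂ : dirDeriv dirEta (dirDeriv dirW R) (x, charPoint (L x)) = 0 :=
        hR.dirEta_dirW_left x.1 x.2 _
      have e₃ : dirDeriv (((1 : ℂ), (0 : ℂ)), (0 : ℂ × ℂ)) (dirDeriv dirW R) = fun y => c * R y :=
        funext hR.dirZ_dirW_eq
      simp [riemannForm, e₁, e₂, he, e₃, pathIntegral_const_mul hR.contDiff]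
      simp [L]
  refine ⟨(key _ hmem).1, ?_⟩
  filter_upwards [hO.mem_nhds hmem] with x hx using (key x hx).2

/-- The solution of the mixed equation whose Goursat data are those of `v` on the second family of
characteristics. -/
theorem solvesMixedAt_snd {a : ℝ → ℂ} {v : ℝ → ℂ → ℂ} (h : IsSolutionAlong c a v)
    (hR : IsRiemannFunction c R) {τ : ℝ} (hτ : τ ∈ Icc (0 : ℝ) 1) (z : ℂ) :
    SolvesMixedAt c (fun x => v τ (starRingEnd ℂ x.2) - pathIntegral R a v τ x (starRingEnd ℂ x.2))
      (z, starRingEnd ℂ (a τ)) := by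
  obtain ⟨r, hr, hs⟩ := h.solves τ hτ
  set O : Set (ℂ × ℂ) := (fun x => starRingEnd ℂ x.2) ⁻¹' Metric.ball (a τ) r with hOdef
  have hO : IsOpen O :=
    Metric.isOpen_ball.preimage (Complex.continuous_conj.comp continuous_snd)
  have hmem : (z, starRingEnd ℂ (a τ)) ∈ O := by simp [hOdef, hr]
  set L : ℂ × ℂ →L[ℝ] ℂ := (Complex.conjCLE : ℂ →L[ℝ] ℂ).comp
    ((ContinuousLinearMap.snd ℂ ℂ ℂ).restrictScalars ℝ)
  set U : ℂ × ℂ → ℂ :=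
    fun x => v τ (starRingEnd ℂ x.2) - pathIntegral R a v τ x (starRingEnd ℂ x.2)
  have hLx : ∀ x, L x = starRingEnd ℂ x.2 := fun x => rfl
  have hchar : ∀ x, charPoint (L x) = (starRingEnd ℂ x.2, x.2) := fun x => by
    simp [charPoint, hLx]
  have key : ∀ x ∈ O, AnalyticAt ℂ U x ∧
      fderiv ℂ (fderiv ℂ U) x (0, 1) (1, 0) = c * U x := fun x hx => by
    refine analyticAt_and_fderiv_fderiv hO
      (g := fun x => -pathIntegral (dirDeriv dirZ R) a v τ x (starRingEnd ℂ x.2)) (fun x hx => ?_)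
      (fun x hx => ?_) hx
    · obtain ⟨Ψ, hΨ, he⟩ := h.hasFDerivAt_pathIntegral_diag hR.toIsHelmholtzKernel hτ hs L hx
      have hv : HasFDerivAt (fun x => v τ (L x)) _ x :=
        HasFDerivAt.comp x (hs (L x) hx).1.hasFDerivAt_wirtinger L.hasFDerivAt
      -- At the endpoint `w̄` the term `∂v dw̄` coming from `v(w̄)` is cancelled by that of the
      -- form, as `R = 1` on `η = w`. What remains is a multiple of `dw`.
      refine ⟨-Ψ + (wirtingerDzbar (v τ) (L x) - dirDeriv dirEta R (x, charPoint (L x)) *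
        v τ (L x)) • ContinuousLinearMap.snd ℂ ℂ ℂ,
        hasFDerivAt_of_restrictScalars ℝ (hv.sub hΨ) ?_, ?_⟩
      · refine ContinuousLinearMap.ext fun y => ?_
        have e₁ : R (x, charPoint (L x)) = 1 := by
          rw [hchar]
          exact hR.eq_one_right x.1 x.2 _
        simp [riemannForm, e₁]
        simp [L]
        ring
      · have e := he (1, 0)
        simp at e ⊢
        exact e
    · obtain ⟨Ψ, hΨ, he⟩ := h.hasFDerivAt_pathIntegral_diag
        (hR.toIsHelmholtzKernel.dirDeriv dirZ) hτ hs L hx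
      refine ⟨_, hΨ.fun_neg, ?_⟩
      have e₁ : dirDeriv dirZ R (x, charPoint (L x)) = 0 := by
        rw [hchar]
        exact hR.dirZ_right x.1 x.2 _
      have e₂ : dirDeriv dirEta (dirDeriv dirZ R) (x, charPoint (L x)) = -c := by
        rw [hchar]
        exact hR.dirEta_dirZ_right x.1 x.2 _
      have e₃ : dirDeriv (((0 : ℂ), (1 : ℂ)), (0 : ℂ × ℂ)) (dirDeriv dirZ R) = fun y => c * R y :=
        (dirDeriv_comm hR.contDiff _ _).trans (funext hR.dirZ_dirW_eq)
      simp [riemannForm, e₁, e₂, he, e₃, pathIntegral_const_mul hR.contDiff]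
      simp [L, U]
      ring
  refine ⟨(key _ hmem).1, ?_⟩
  filter_upwards [hO.mem_nhds hmem] with x hx
  rw [(key x hx).1.fderiv_fderiv_comm, (key x hx).2]

end IsSolutionAlong

/-- The sum of the two Goursat solutions: a solution of the mixed equation near every point
`(a₁ τ, conj (a₂ τ))`, which is continued along the path and starts as the extension of `v₂ 0` from
the real plane. -/
theorem exists_continuation_mixed {c : ℂ} {a₁ a₂ : ℝ → ℂ} {v₁ v₂ : ℝ → ℂ → ℂ}
    (h₁ : IsSolutionAlong c a₁ v₁) (h₂ : IsSolutionAlong c a₂ v₂) (ha : a₁ 0 = a₂ 0)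
    (hv : v₁ 0 = v₂ 0) : ∃ U : ℝ → ℂ × ℂ → ℂ,
      (∀ τ ∈ Icc (0 : ℝ) 1, SolvesMixedAt c (U τ) (a₁ τ, starRingEnd ℂ (a₂ τ))) ∧
      (∀ τ ∈ Icc (0 : ℝ) 1, ∀ᶠ τ' in 𝓝[Icc 0 1] τ,
        U τ' =ᶠ[𝓝 (a₁ τ', starRingEnd ℂ (a₂ τ'))] U τ) ∧
      ∀ z, U 0 (charPoint z) = v₂ 0 z := by
  obtain ⟨R, hR⟩ := exists_isRiemannFunction c
  refine ⟨fun τ x => pathIntegral R a₁ v₁ τ x x.1 + (v₂ τ (starRingEnd ℂ x.2) -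
    pathIntegral R a₂ v₂ τ x (starRingEnd ℂ x.2)), fun τ hτ =>
    (h₁.solvesMixedAt_fst hR hτ _).add (h₂.solvesMixedAt_snd hR hτ _), fun τ hτ => ?_, fun z => ?_⟩
  · filter_upwards [h₁.pathIntegral_coherent hR.toIsHelmholtzKernel hτ,
      h₂.pathIntegral_coherent hR.toIsHelmholtzKernel hτ, h₂.coherent τ hτ] with τ' e₁ e₂ e₃
    have t₁ : Tendsto Prod.fst (𝓝 (a₁ τ', starRingEnd ℂ (a₂ τ'))) (𝓝 (a₁ τ')) :=
      continuous_fst.continuousAt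
    have t₂ : Tendsto (fun x : ℂ × ℂ => starRingEnd ℂ x.2) (𝓝 (a₁ τ', starRingEnd ℂ (a₂ τ')))
        (𝓝 (a₂ τ')) := by
      simpa [Function.comp_def] using (Complex.continuous_conj.comp continuous_snd).tendsto
        (a₁ τ', starRingEnd ℂ (a₂ τ'))
    filter_upwards [t₁.eventually e₁, t₂.eventually e₂, t₂.eventually e₃] with x f₁ f₂ f₃
    rw [f₁, f₂, f₃]
  -- At `τ = 0` the path parts are empty, and for `w = z̄` the two segment integrals coincide and
  -- cancel.
  · simp [charPoint, pathIntegral, kernelIntegral, ha, hv]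

/-! ### Return to the coordinates `x₁`, `x₂` -/

/-- The complex-linear map `(x₁, x₂) ↦ (x₁ + i x₂, x₁ - i x₂)`. -/
noncomputable def charCoord : ℂ × ℂ →L[ℂ] ℂ × ℂ :=
  (ContinuousLinearMap.fst ℂ ℂ ℂ + Complex.I • ContinuousLinearMap.snd ℂ ℂ ℂ).prod
    (ContinuousLinearMap.fst ℂ ℂ ℂ - Complex.I • ContinuousLinearMap.snd ℂ ℂ ℂ)

theorem charCoord_apply (x : ℂ × ℂ) :
    charCoord x = (x.1 + Complex.I * x.2, x.1 - Complex.I * x.2) := by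
  simp [charCoord]

theorem charCoord_eq_realPoint (x : ℂ × ℂ) :
    charCoord x = (realPoint₁ x, starRingEnd ℂ (realPoint₂ x)) := by
  rw [charCoord_apply, realPoint₁_eq, realPoint₂_eq, Complex.conj_conj]

theorem charCoord_ofPlane (z : ℂ) : charCoord (ofPlane z) = charPoint z := by
  rw [charCoord_eq_realPoint, realPoint₁_ofPlane, realPoint₂_ofPlane, charPoint]

/-- `∂₁ = ∂_z + ∂_w` and `∂₂ = i (∂_z - ∂_w)`, whence `∂₁² + ∂₂² = 4 ∂_z ∂_w`. -/
theorem SolvesMixedAt.helmholtz {k : ℂ} {U : ℂ × ℂ → ℂ} {x : ℂ × ℂ}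
    (h : SolvesMixedAt (-(k ^ 2) / 4) U (charCoord x)) :
    ∀ᶠ y in 𝓝 x, iteratedFDeriv ℂ 2 (fun x => U (charCoord x)) y ![(1, 0), (1, 0)] +
      iteratedFDeriv ℂ 2 (fun x => U (charCoord x)) y ![(0, 1), (0, 1)] +
      k ^ 2 * U (charCoord y) = 0 := by
  have ht : Tendsto charCoord (𝓝 x) (𝓝 (charCoord x)) := charCoord.continuous.continuousAt
  have hd : ∀ {y}, AnalyticAt ℂ U (charCoord y) → fderiv ℂ (fun x => U (charCoord x)) =ᶠ[𝓝 y]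
      fun y => (fderiv ℂ U (charCoord y)).comp charCoord := fun {y} hy => by
    filter_upwards [charCoord.continuous.continuousAt.eventually hy.eventually_analyticAt]
      with z hz
    exact (hz.differentiableAt.hasFDerivAt.comp z charCoord.hasFDerivAt).fderiv
  filter_upwards [ht.eventually h.eqn, ht.eventually h.analyticAt.eventually_analyticAt]
    with y hy ha
  have h₂ : ∀ v w, fderiv ℂ (fderiv ℂ fun x => U (charCoord x)) y v w =
      fderiv ℂ (fderiv ℂ U) (charCoord y) (charCoord v) (charCoord w) := fun v w => by
    rw [(hd ha).fderiv_eq]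
    have h₃ : HasFDerivAt (fun y => fderiv ℂ U (charCoord y)) _ y :=
      ha.fderiv.differentiableAt.hasFDerivAt.comp y charCoord.hasFDerivAt
    rw [(h₃.clm_comp (hasFDerivAt_const charCoord y)).fderiv]
    simp
  have e₁ : charCoord (1, 0) = ((1, 0) : ℂ × ℂ) + (0, 1) := by simp [charCoord_apply]
  have e₂ : charCoord (0, 1) = Complex.I • (((1, 0) : ℂ × ℂ) - (0, 1)) := by
    simp [charCoord_apply]
  have hc := ha.fderiv_fderiv_comm (0, 1) (1, 0)
  rw [hy] at hc
  simp only [iteratedFDeriv_two_apply, Matrix.cons_val_zero, Matrix.cons_val_one, h₂, e₁, e₂,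
    map_add, map_sub, map_smul, add_apply, sub_apply, smul_apply, smul_eq_mul, hc, hy]
  linear_combination (fderiv ℂ (fderiv ℂ U) (charCoord y) (1, 0) (1, 0) +
    fderiv ℂ (fderiv ℂ U) (charCoord y) (0, 1) (0, 1) + k ^ 2 / 2 * U (charCoord y)) *
      Complex.I_sq

/-! ### Branches of `u` along lifted paths, and the theorem -/

namespace SommerfeldSurface

variable {N M K : ℕ} {S : SommerfeldSurface N M K}

theorem exists_isLocalSheet (p : S.Pt) : ∃ (V : Set ℂ) (s : ℂ → S.Pt), IsOpen V ∧ p.base ∈ V ∧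
    S.IsLocalSheet V s ∧ s p.base = p ∧ ∀ᶠ q in 𝓝 p, s q.base = q := by
  have : Nonempty (Fin M) := ⟨p.sheet⟩
  obtain ⟨e, hp, he⟩ := S.isLocalHomeomorph_base p
  refine ⟨e.target, e.symm, e.open_target, he ▸ e.map_source hp,
    ⟨e.continuousOn_symm, fun z hz => ?_⟩, ?_, ?_⟩
  · rw [he]
    exact e.right_inv hz
  · rw [he]
    exact e.left_inv hp
  · filter_upwards [e.open_source.mem_nhds hp] with q hq
    rw [he]
    exact e.left_inv hq

/-- The branches of `u` along the lift of a path to the surface. -/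
theorem ObeysHelmholtz.exists_isSolutionAlong {k : ℂ} {u : S.Pt → ℂ} (hu : S.ObeysHelmholtz k u)
    {V : S.Pt → Set ℂ} {s : S.Pt → ℂ → S.Pt} (hV : ∀ p, IsOpen (V p))
    (hbV : ∀ p, p.base ∈ V p) (hs : ∀ p, S.IsLocalSheet (V p) (s p)) (hsp : ∀ p, s p p.base = p)
    (hsq : ∀ p, ∀ᶠ q in 𝓝 p, s p q.base = q) {a : ℝ → ℂ} (ha : ContDiffOn ℝ 1 a (Icc 0 1))
    {A₀ : S.Pt} (ha₀ : a 0 = A₀.base) (haP : ∀ τ ∈ Icc (0 : ℝ) 1, a τ ∉ S.branch) :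
    ∃ v, IsSolutionAlong (-(k ^ 2) / 4) a v ∧ v 0 = fun z => u (s A₀ z) := by
  have : Nonempty (Fin M) := ⟨A₀.sheet⟩
  obtain ⟨F, ⟨hF0, hF⟩, -⟩ := S.existsUnique_lift
    (ha.continuousOn.comp_continuous (continuous_subtype_val.comp
      (continuous_projIcc (h := zero_le_one))) fun τ => Subtype.prop _)
    (fun τ => haP _ (Subtype.prop _)) (x₀ := 0) (p := A₀) (by simp [ha₀])
  have hFb : ∀ τ ∈ Icc (0 : ℝ) 1, (F τ).base = a τ := fun τ hτ => by
    simpa [projIcc_of_mem _ hτ] using congrFun hF τ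
  refine ⟨fun τ z => u (s (F τ) z), ⟨ha, fun τ hτ => ?_, fun τ hτ => ?_⟩, by simp only [hF0]⟩
  · obtain ⟨r, hr, hsub⟩ := Metric.isOpen_iff.1 (hV (F τ)) (a τ) (hFb τ hτ ▸ hbV (F τ))
    obtain ⟨hc, hl⟩ := hu _ _ (hV (F τ)) (hs (F τ))
    exact ⟨r, hr, (solvesOn_of_helmholtz (hV _) hc hl).mono hsub⟩
  · filter_upwards [self_mem_nhdsWithin, mem_nhdsWithin_of_mem_nhds
      (F.continuous.continuousAt.eventually (eventually_eventually_nhds.2 (hsq (F τ))))]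
      with τ' hτ' h
    rw [← hFb τ' hτ']
    have hnhds := (hV (F τ')).mem_nhds (hbV (F τ'))
    have hc : ContinuousAt (s (F τ')) (F τ').base := (hs (F τ')).1.continuousAt hnhds
    -- For `τ'` near `τ` the sheet through `F τ'` stays, near `F τ'`, among the points through which
    -- the sheet of `F τ` passes; so the two sheets, and the branches of `u` read on them, agree
    -- there.
    have h' := hc.eventually (p := fun q => s (F τ) q.base = q) (by rw [hsp]; exact h)
    filter_upwards [h', hnhds] with z h₁ hz
    rw [(hs (F τ')).2 z hz] at h₁
    rw [h₁]

/-- The paths of the two real points are lifted separately from `A₀` and may end on different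
sheets; the continued germ combines the two branches of `u`. The path must be `C¹` for the integrals
along it. -/
theorem ObeysHelmholtz.exists_isContinuationAlong {k : ℂ} {u : S.Pt → ℂ}
    (hu : S.ObeysHelmholtz k u) {A₀ : S.Pt} {σ : ℝ → ℂ × ℂ} (hσ : ContDiffOn ℝ 1 σ (Icc 0 1))
    (hσ₀ : σ 0 = ofPlane A₀.base) (hσT : ∀ τ ∈ Ioc (0 : ℝ) 1, σ τ ∉ S.T) :
    ∃ f, S.IsContinuationAlong k u A₀ σ f := by
  choose V s hV hbV hs hsp hsq using exists_isLocalSheet (S := S)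
  have hP : ∀ τ ∈ Icc (0 : ℝ) 1, realPoint₁ (σ τ) ∉ S.branch ∧ realPoint₂ (σ τ) ∉ S.branch := by
    intro τ hτ
    simp only [S.notMem_branch]
    rcases hτ.1.eq_or_lt with rfl | h
    · rw [hσ₀, realPoint₁_ofPlane, realPoint₂_ofPlane]
      exact ⟨A₀.base_ne, A₀.base_ne⟩
    · exact ⟨realPoint₁_ne_of_notMem_T (hσT τ ⟨h, hτ.2⟩),
        realPoint₂_ne_of_notMem_T (hσT τ ⟨h, hτ.2⟩)⟩
  have hc₁ : ContDiffOn ℝ 1 (fun τ => realPoint₁ (σ τ)) (Icc 0 1) := by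
    simp only [realPoint₁_eq]
    exact hσ.fst.add (contDiffOn_const.mul hσ.snd)
  have hc₂ : ContDiffOn ℝ 1 (fun τ => realPoint₂ (σ τ)) (Icc 0 1) := by
    simp only [realPoint₂_eq]
    exact Complex.conjCLE.contDiff.comp_contDiffOn (hσ.fst.sub (contDiffOn_const.mul hσ.snd))
  obtain ⟨v₁, h₁, e₁⟩ := hu.exists_isSolutionAlong hV hbV hs hsp hsq hc₁ (A₀ := A₀)
    (by rw [hσ₀, realPoint₁_ofPlane]) fun τ hτ => (hP τ hτ).1
  obtain ⟨v₂, h₂, e₂⟩ := hu.exists_isSolutionAlong hV hbV hs hsp hsq hc₂ (A₀ := A₀)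
    (by rw [hσ₀, realPoint₂_ofPlane]) fun τ hτ => (hP τ hτ).2
  obtain ⟨U, hU, hcoh, hstart⟩ := exists_continuation_mixed h₁ h₂
    (by simp only [hσ₀, realPoint₁_ofPlane, realPoint₂_ofPlane]) (e₁.trans e₂.symm)
  simp only [← charCoord_eq_realPoint] at hU hcoh
  refine ⟨fun τ x => U τ (charCoord x), fun τ hτ => ?_, fun τ hτ => (hU τ hτ).helmholtz,
    fun τ hτ => ?_, V A₀, s A₀, hV _, hbV _, hs _, hsp _, fun z _ => ?_⟩
  · exact (hU τ hτ).analyticAt.comp (charCoord.analyticAt _)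
  · filter_upwards [hcoh τ hτ] with τ' h
    exact charCoord.continuous.continuousAt.eventually h
  · rw [charCoord_ofPlane, hstart, e₂]

end SommerfeldSurface

theorem mainTheorem5 {N M K : ℕ} (S : SommerfeldSurface N M K) (A₀ : S.Pt)
    (B : ℂ × ℂ) (hB : B ∉ S.T ∪ realPlane)
    (σ : ℝ → ℂ × ℂ) (hσ : ContDiffOn ℝ 1 σ (Icc 0 1))
    (hσ₀ : σ 0 = ofPlane A₀.base) (hσ₁ : σ 1 = B)
    (hσT : ∀ τ ∈ Ioc (0 : ℝ) 1, σ τ ∉ S.T ∪ realPlane) :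
    (∀ γ : ℝ → S.Pt, S.IsSmallBoundary A₀ γ →
      ∃ Γ : ℝ → ℝ → S.Pt, S.IsContourFamily σ γ Γ) ∧
    (∀ (k : ℂ) (u : S.Pt → ℂ), S.ObeysHelmholtz k u →
      ∃ f : ℝ → ℂ × ℂ → ℂ, S.IsContinuationAlong k u A₀ σ f) :=
  ⟨fun _ hγ => SommerfeldSurface.exists_isContourFamily hσ.continuousOn hσ₀ hσT hγ,
    fun _ _ hu => hu.exists_isContinuationAlong hσ hσ₀ fun τ hτ h => hσT τ hτ (Or.inl h)⟩
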